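/- Let $R$ be $\mathbb Z$, $\mathbb Q$ or $\mathbb Z_p=\mathbb Z/p$ with $p$ prime, and work in the category of all groups. For a group $A$ put $A_1=A^r_1=A_{p,1}=A$ and, for $n\ge 1$, $$A_{n+1}=[A_n,A],\qquad A^r_{n+1}=\{x\in A\mid x^k\in[A,A^r_n]\text{ for some integer }k>0\},\qquad A_{p,n+1}=(A_{p,n})^p[A_{p,n},A],$$ and let $A^R_n$ be $A_n$, $A^r_n$, $A_{p,n}$ for $R=\mathbb Z,\mathbb Q,\mathbb Z_p$ respectively. The $R$-lower central series is the normal series $\Gamma^n(A)=A^R_{n+1}$, $n\ge 0$. For $n\ge1$ let $\Phi^R_n(A)$ be the kernel of the natural map $H_2(A;R)\to H_2(A/A_n;R)$, and put $\Phi^R_0(A)=H_2(A;R)$. Let $(\mathcal H^R_{Dwyer})^n$ be the collection of all homomorphisms $f:A\to B$ of groups that induce an isomorphism $H_1(A;R)\to H_1(B;R)$ and an epimorphism $H_2(A;R)/\Phi^R_n(A)\to H_2(B;R)/\Phi^R_n(B)$. Then the $R$-lower central series is stable with respect to $\mathcal H^R_{Dwyer}=\{(\mathcal H^R_{Dwyer})^n\}_{n\ge0}$.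 That is: 1. Each $(\mathcal H^R_{Dwyer})^n$ is a class of maps: it contains all isomorphisms, is closed under composition, and for any two of its members $f:A\to B$, $f':A\to B'$ there are members $g:B\to C$, $g':B'\to C$ with $gf=g'f'$. Moreover $(\mathcal H^R_{Dwyer})^{n+1}\subseteq(\mathcal H^R_{Dwyer})^n$. 2. If $f:A\to B$ is in $(\mathcal H^R_{Dwyer})^n$, then $f(\Gamma^n(A))\subseteq\Gamma^n(B)$. 3. For every $n\ge 0$ and every group $A$, $$\{a\in A\mid \text{there is } f:A\to B\text{ in }(\mathcal H^R_{Dwyer})^n\text{ with } f(a)\in\Gamma^n(B)\}=\Gamma^n(A).$$ The same holds if $A/A_n$ is replaced by $A/A^R_n$ in the definition of $\Phi^R_n$. -/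

import Mathlib

open CategoryTheory

universe u

/-! ### Normal series, classes of maps, stability -/

/-- A normal series on the category of all groups:
`⋯ ⊆ Γ^{n+1}(A) ⊆ Γ^n(A) ⊆ ⋯ ⊆ Γ^0(A) = A`, each term a normal subgroup of `A`. -/
structure NormalSeries where
  /-- the `n`-th subgroup function -/
  term : ℕ → ∀ (A : Type u) [Group A], Subgroup A
  normal : ∀ (n : ℕ) (A : Type u) [Group A], (term n A).Normal
  term_succ_le : ∀ (n : ℕ) (A : Type u) [Group A], term (n + 1) A ≤ term n A
  term_zero : ∀ (A : Type u) [Group A], term 0 A = ⊤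

attribute [instance] NormalSeries.normal

/-- A collection of group homomorphisms. -/
def GroupMaps : Type (u + 1) :=
  ∀ ⦃A B : Type u⦄ [Group A] [Group B], (A →* B) → Prop

/-- A class of maps: it contains all isomorphisms and is closed under composition and nudge-outs. -/
structure IsClassOfMaps (H : GroupMaps.{u}) : Prop where
  of_mulEquiv : ∀ {A B : Type u} [Group A] [Group B] (e : A ≃* B), H e.toMonoidHom
  comp : ∀ {A B C : Type u} [Group A] [Group B] [Group C] (f : A →* B) (g : B →* C),
    H f → H g → H (g.comp f)
  nudge_out : ∀ {A B B' : Type u} [Group A] [Group B] [Group B'] (f : A →* B) (f' : A →* B'),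
    H f → H f' → ∃ (C : Type u) (_ : Group C) (g : B →* C) (g' : B' →* C),
      H g ∧ H g' ∧ g.comp f = g'.comp f'

/-- A nested collection `⋯ ⊆ H^1 ⊆ H^0` of classes of maps. -/
structure IsNestedClassOfMaps (H : ℕ → GroupMaps.{u}) : Prop where
  isClass : ∀ n, IsClassOfMaps (H n)
  nested : ∀ (n : ℕ) {A B : Type u} [Group A] [Group B] (f : A →* B), H (n + 1) f → H n f

namespace NormalSeries

/-- `Γ` is invariant with respect to `H` if `f (Γ^n A) ⊆ Γ^n B` for all `f : A → B` in `H^n`. -/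
def IsInvariant (Γ : NormalSeries.{u}) (H : ℕ → GroupMaps.{u}) : Prop :=
  ∀ (n : ℕ) {A B : Type u} [Group A] [Group B] (f : A →* B), H n f →
    (Γ.term n A).map f ≤ Γ.term n B

/-- The `n`-th term of the stabilization of `Γ` with respect to `H`:
all `a ∈ A` for which some `f : A → B` in `H^n` has `f a ∈ Γ^n B`. -/
def stabilization (Γ : NormalSeries.{u}) (H : ℕ → GroupMaps.{u}) (n : ℕ)
    (A : Type u) [Group A] : Set A :=
  {a | ∃ (B : Type u) (_ : Group B) (f : A →* B), H n f ∧ f a ∈ Γ.term n B}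

/-- `Γ` is stable under the nested collection of classes of maps `H`: it is `H`-invariant and each
`Γ^n` agrees with its stabilization with respect to `H^n`. -/
structure IsStable (Γ : NormalSeries.{u}) (H : ℕ → GroupMaps.{u}) : Prop where
  isNestedClass : IsNestedClassOfMaps H
  isInvariant : Γ.IsInvariant H
  stabilization_eq : ∀ (n : ℕ) (A : Type u) [Group A], Γ.stabilization H n A = Γ.term n A

end NormalSeries

/-! ### The `R`-lower central series, indexed so that `Γ^n(A) = A_{n+1}` -/

section Series

variable {A : Type u} [Group A]

/-- The lower central series `A_1 = A`, `A_{n+1} = [A_n, A]`, with `Γ^n(A) = A_{n+1}`. -/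
def lowerCentral : NormalSeries.{u} where
  term n A _ := (⊤ : Subgroup A).lowerCentralSeries n
  normal _ _ _ := inferInstance
  term_succ_le _ _ _ := Subgroup.commutator_le_left _ _
  term_zero _ _ := rfl

variable (A) in
/-- The rational lower central series with index shifted by one: `A^r_1 = A`, and `A^r_{n+1}` is
the subgroup (generated by) `{x | x ^ k ∈ [A, A^r_n] for some positive integer k}`.
This set is already a subgroup: see `mem_rationalLCS_succ`. -/
def rationalLCS : ℕ → Subgroup A
  | 0 => ⊤
  | n + 1 => Subgroup.closure {x | ∃ k : ℕ, 0 < k ∧ x ^ k ∈ ⁅(⊤ : Subgroup A), rationalLCS n⁆}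

lemma rationalLCS_normal (n : ℕ) : (rationalLCS A n).Normal := by
  induction n with
  | zero => exact inferInstanceAs (⊤ : Subgroup A).Normal
  | succ n ih =>
    rw [← Subgroup.normalizer_eq_top_iff, eq_top_iff, rationalLCS, Subgroup.le_normalizer_closure_iff]
    rintro h - g ⟨k, hk, hg⟩
    refine Subgroup.subset_closure ⟨k, hk, ?_⟩
    rw [conj_pow]
    exact (inferInstance : (⁅(⊤ : Subgroup A), rationalLCS A n⁆).Normal).conj_mem _ hg h

lemma rationalLCS_succ_le (n : ℕ) : rationalLCS A (n + 1) ≤ rationalLCS A n := by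
  induction n with
  | zero => exact le_top
  | succ n ih =>
    refine Subgroup.closure_mono ?_
    rintro x ⟨k, hk, hx⟩
    exact ⟨k, hk, Subgroup.commutator_mono le_rfl ih hx⟩

/-- `A^r_{n+1} = {x | x ^ k ∈ [A, A^r_n] for some positive integer k}`. -/
lemma mem_rationalLCS_succ (n : ℕ) (x : A) :
    x ∈ rationalLCS A (n + 1) ↔ ∃ k : ℕ, 0 < k ∧ x ^ k ∈ ⁅(⊤ : Subgroup A), rationalLCS A n⁆ := by
  have := rationalLCS_normal (A := A) n
  refine ⟨fun hx => ?_, fun hx => Subgroup.subset_closure hx⟩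
  rw [rationalLCS] at hx
  induction hx using Subgroup.closure_induction with
  | mem x hx => exact hx
  | one => exact ⟨1, one_pos, by simp⟩
  | inv x _ hx =>
    obtain ⟨k, hk, hx⟩ := hx
    exact ⟨k, hk, by rw [inv_pow]; exact inv_mem hx⟩
  | mul x y _ hy hx' hy' =>
    obtain ⟨k, hk, hx⟩ := hx'
    obtain ⟨m, hm, hy''⟩ := hy'
    refine ⟨k * m, Nat.mul_pos hk hm, ?_⟩
    have hyn : y ∈ rationalLCS A n := rationalLCS_succ_le n hy
    have hc : Commute (x : A ⧸ ⁅(⊤ : Subgroup A), rationalLCS A n⁆) (y : A ⧸ _) := by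
      rw [← commutatorElement_eq_one_iff_commute]
      exact (QuotientGroup.eq_one_iff _).2
        (Subgroup.commutator_mem_commutator (Subgroup.mem_top x) hyn)
    rw [← QuotientGroup.eq_one_iff] at hx hy'' ⊢
    rw [QuotientGroup.mk_pow] at hx hy''
    rw [QuotientGroup.mk_pow, QuotientGroup.mk_mul, hc.mul_pow, pow_mul, hx, mul_comm k m, pow_mul,
      hy'', one_pow, one_pow, one_mul]

/-- The rational lower central series, with `Γ^n(A) = A^r_{n+1}`. -/
def rationalLowerCentral : NormalSeries.{u} where
  term n A _ := rationalLCS A n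
  normal n _ _ := rationalLCS_normal n
  term_succ_le n _ _ := rationalLCS_succ_le n
  term_zero _ _ := rfl

variable (A) in
/-- The `ℤ/p`-lower central series with index shifted by one: `A_{p,1} = A` and
`A_{p,n+1} = (A_{p,n})^p [A_{p,n}, A]`, where `(A_{p,n})^p` is generated by the `p`-th powers of
elements of `A_{p,n}`. -/
def modPLCS (p : ℕ) : ℕ → Subgroup A
  | 0 => ⊤
  | n + 1 => Subgroup.closure {x | ∃ y ∈ modPLCS p n, y ^ p = x} ⊔ ⁅modPLCS p n, (⊤ : Subgroup A)⁆

lemma modPLCS_normal (p n : ℕ) : (modPLCS A p n).Normal := by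
  induction n with
  | zero => exact inferInstanceAs (⊤ : Subgroup A).Normal
  | succ n ih =>
    have : (Subgroup.closure {x | ∃ y ∈ modPLCS A p n, y ^ p = x}).Normal := by
      rw [← Subgroup.normalizer_eq_top_iff, eq_top_iff, Subgroup.le_normalizer_closure_iff]
      rintro h - _ ⟨y, hy, rfl⟩
      exact Subgroup.subset_closure ⟨h * y * h⁻¹, ih.conj_mem _ hy h, conj_pow⟩
    rw [modPLCS]
    infer_instance

lemma modPLCS_succ_le (p n : ℕ) : modPLCS A p (n + 1) ≤ modPLCS A p n := by
  have := modPLCS_normal (A := A) p n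
  rw [modPLCS, sup_le_iff, Subgroup.closure_le]
  refine ⟨?_, Subgroup.commutator_le_left _ _⟩
  rintro _ ⟨y, hy, rfl⟩
  exact pow_mem hy p

/-- The `ℤ/p`-lower central series, with `Γ^n(A) = A_{p,n+1}`. -/
def modPLowerCentral (p : ℕ) : NormalSeries.{u} where
  term n A _ := modPLCS A p n
  normal n _ _ := modPLCS_normal p n
  term_succ_le n _ _ := modPLCS_succ_le p n
  term_zero _ _ := rfl

end Series

/-! ### Group homology and Dwyer's classes of maps -/

section Homology

variable (R : Type) [CommRing R] {A B : Type u} [Group A] [Group B]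

/-- `H_i(A; R)` with trivial coefficients. The ring is lifted to the universe of `A`. -/
noncomputable abbrev trivHomology (A : Type u) [Group A] (i : ℕ) : ModuleCat.{u} (ULift.{u} R) :=
  groupHomology (Rep.trivial (ULift.{u} R) A (ULift.{u} R)) i

/-- The map `f_* : H_i(A; R) → H_i(B; R)` induced by a homomorphism `f : A → B`. -/
noncomputable def trivHomologyMap (f : A →* B) (i : ℕ) :
    trivHomology R A i →ₗ[ULift.{u} R] trivHomology R B i :=
  (groupHomology.map f
    (𝟙 (Rep.trivial (ULift.{u} R) A (ULift.{u} R)) :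
      Rep.trivial (ULift.{u} R) A (ULift.{u} R) ⟶
        Rep.res f (Rep.trivial (ULift.{u} R) B (ULift.{u} R))) i).hom

/-- Dwyer's filtration `Φ_n(A) = ker (H_2(A; R) → H_2(A / A_n; R))` for a series
`A = A_1 ⊇ A_2 ⊇ ⋯`, presented by `N` with `N^k(A) = A_{k+1}`. For `n = 0`, which only serves to
index the `0`-th class of maps, `A_0` is read as `A`. -/
noncomputable def dwyerPhi (N : NormalSeries.{u}) (n : ℕ) (A : Type u) [Group A] :
    Submodule (ULift.{u} R) (trivHomology R A 2) :=
  LinearMap.ker (trivHomologyMap R (QuotientGroup.mk' (N.term (n - 1) A)) 2)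

/-- The `n`-th Dwyer `R`-class: the maps `f : A → B` inducing an isomorphism on `H_1(-; R)` and an
epimorphism `H_2(A; R) / Φ_n(A) → H_2(B; R) / Φ_n(B)`. (The inclusion `h` says that `f_*` descends
to these quotients; it holds as soon as the terms of `N` are preserved by `f`.) -/
def dwyerClass (N : NormalSeries.{u}) (n : ℕ) : GroupMaps.{u} := fun A B _ _ f =>
  Function.Bijective (trivHomologyMap R f 1) ∧
    ∃ h : dwyerPhi R N n A ≤ (dwyerPhi R N n B).comap (trivHomologyMap R f 2),
      Function.Surjective ((dwyerPhi R N n A).mapQ (dwyerPhi R N n B) (trivHomologyMap R f 2) h)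

end Homology

/-!
The theorem is proved through homomorphisms into nilpotent groups. The homology groups enter only
through two facts about maps to a module `M` with trivial action:

* `f : A → B` is an isomorphism on `H_1(-; R)` if and only if homomorphisms to `R`-modules extend
  uniquely along `f` (`bijective_trivHomologyMap_one_iff`);
* a function `c : G × G → M` whose linear extension vanishes on the `2`-cycles of `G` becomes a
  coboundary in a larger module (`exists_coboundary_of_vanishing`), and if moreover it is a
  coboundary after restriction along an `H_1`-isomorphism to `G`, it is one already in `M`
  (`exists_coboundary_of_restriction`). No injectivity of `M` is needed.

Call a group `R`-nilpotent of class at most `n` if it is an `n`-fold iterated central extension by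
`R`-modules. Both the `R`-lower central series and the ordinary one vanish on such groups. Dwyer's
theorem then reads: along a map `A → B` in the `n`-th Dwyer class, every homomorphism from `A` to
an `R`-nilpotent group `K` of class at most `n` extends to `B` (`exists_extension_of_dwyerClass`).
In the inductive step `K` is a central extension of `K'` by `M`, and the map `B → K'` obtained
before factors through `B` modulo the term of the series used to form `Φ_n`. The obstruction to
lifting it to `K` is pulled back from that quotient and vanishes on `A`, so by the condition on
`H_2` it vanishes on the cycles of `B`, and then by the condition on `H_1` it is zero.

Consequently `f a ∈ Γ^n(B)` implies `a ∈ Γ^n(A)` as soon as the elements outside `Γ^n(A)` are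
detected by homomorphisms from `A` to `R`-nilpotent groups of class at most `n`
(`isStable_dwyerClass`). For `R = ℤ` and `R = ℤ/p` the quotient `A / Γ^n(A)` is itself such a group.
For `R = ℚ` a group with unique roots is needed, and the Malcev completion is replaced by the
following construction (`exists_uniquelyDivisible_detecting`). One reduces to a central element of
infinite order in a nilpotent group; in every finitely generated subgroup and for every prime `p` it
survives in some quotient that is a `p`-group (`exists_isPGroup_quotient`); and a reduced product of
such `p`-groups with `p → ∞` has unique roots, since the `k`-th power map is bijective on a
`p`-group if `p > k`.

For two maps out of `A` in a Dwyer class, the square that closes them up is the pushout of groups: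
`H_2(B) ⊕ H_2(B') → H_2(C)` is onto if `H_1(A) → H_1(B)` is an isomorphism
(`IsGroupPushout.exists_H₂_eq_add`).
-/

/-! ### Low degree homology through the bar complex -/

section BarChains

open groupHomology

variable (R : Type) [CommRing R] {A B : Type u} [Group A] [Group B]

variable (A) in
/-- The differential `C_2(A; R) → C_1(A; R)` of the bar complex with trivial coefficients. -/
noncomputable def barD₂ : (A × A →₀ ULift.{u} R) →ₗ[ULift.{u} R] (A →₀ ULift.{u} R) :=
  (d₂₁ (Rep.trivial (ULift.{u} R) A (ULift.{u} R))).hom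

variable (A) in
/-- The differential `C_3(A; R) → C_2(A; R)` of the bar complex with trivial coefficients. -/
noncomputable def barD₃ : (A × A × A →₀ ULift.{u} R) →ₗ[ULift.{u} R] (A × A →₀ ULift.{u} R) :=
  (d₃₂ (Rep.trivial (ULift.{u} R) A (ULift.{u} R))).hom

open Finsupp in
lemma barD₂_single (g h : A) (r : ULift.{u} R) :
    barD₂ R A (single (g, h) r) = single h r - single (g * h) r + single g r := by
  have := d₂₁_single (A := Rep.trivial (ULift.{u} R) A (ULift.{u} R)) (g, h) r
  simpa [barD₂] using this

open Finsupp in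
lemma barD₃_single (g h k : A) (r : ULift.{u} R) :
    barD₃ R A (single (g, h, k) r) =
      single (h, k) r - single (g * h, k) r + single (g, h * k) r - single (g, h) r := by
  have := d₃₂_single (A := Rep.trivial (ULift.{u} R) A (ULift.{u} R)) (g, h, k) r
  simpa [barD₃] using this

/-- The morphism of trivial representations over `f` that underlies `trivHomologyMap R f`. -/
noncomputable abbrev trivRepMap (f : A →* B) :
    Rep.trivial (ULift.{u} R) A (ULift.{u} R) ⟶
      Rep.res f (Rep.trivial (ULift.{u} R) B (ULift.{u} R)) :=
  𝟙 (Rep.trivial (ULift.{u} R) A (ULift.{u} R))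

/-- The projection from `1`-chains, all of which are cycles, onto `H_1(A; R)`. -/
noncomputable def toH₁ : (A →₀ ULift.{u} R) →ₗ[ULift.{u} R] trivHomology R A 1 :=
  (H1π (Rep.trivial (ULift.{u} R) A (ULift.{u} R))).hom ∘ₗ
    LinearMap.codRestrict (cycles₁ (Rep.trivial (ULift.{u} R) A (ULift.{u} R))) LinearMap.id
      (fun x => by rw [cycles₁_eq_top_of_isTrivial]; trivial)

lemma toH₁_surjective : Function.Surjective (toH₁ R (A := A)) := fun y => by
  induction y using H1_induction_on with
  | h x => exact ⟨x.1, rfl⟩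

lemma toH₁_eq_zero_iff (x : A →₀ ULift.{u} R) :
    toH₁ R x = 0 ↔ x ∈ LinearMap.range (barD₂ R A) :=
  H1π_eq_zero_iff (A := Rep.trivial (ULift.{u} R) A (ULift.{u} R)) ⟨x, _⟩

lemma trivHomologyMap_toH₁ (f : A →* B) (x : A →₀ ULift.{u} R) :
    trivHomologyMap R f 1 (toH₁ R x) = toH₁ R (x.mapDomain f) := by
  have h := H1π_comp_map (k := ULift.{u} R) (f := f) (φ := trivRepMap R f)
  refine (LinearMap.congr_fun (congrArg ModuleCat.Hom.hom h) ⟨x, _⟩).trans ?_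
  refine congrArg (H1π (Rep.trivial (ULift.{u} R) B (ULift.{u} R))).hom (Subtype.ext ?_)
  refine (coe_mapCycles₁ _ _ _).trans ?_
  exact Finsupp.mapRange_id _

/-- The projection from `2`-cycles onto `H_2(A; R)`. -/
noncomputable def toH₂ : LinearMap.ker (barD₂ R A) →ₗ[ULift.{u} R] trivHomology R A 2 :=
  (H2π (Rep.trivial (ULift.{u} R) A (ULift.{u} R))).hom

lemma toH₂_surjective : Function.Surjective (toH₂ R (A := A)) := fun y => by
  induction y using H2_induction_on with
  | h x => exact ⟨x, rfl⟩

lemma toH₂_eq_zero_iff (x : LinearMap.ker (barD₂ R A)) :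
    toH₂ R x = 0 ↔ x.1 ∈ LinearMap.range (barD₃ R A) :=
  H2π_eq_zero_iff (A := Rep.trivial (ULift.{u} R) A (ULift.{u} R)) x

lemma barD₂_mapDomain (f : A →* B) (x : A × A →₀ ULift.{u} R) :
    barD₂ R B (x.mapDomain (Prod.map f f)) = (barD₂ R A x).mapDomain f := by
  induction x using Finsupp.induction_linear with
  | zero => simp
  | add x y hx hy => simp [Finsupp.mapDomain_add, hx, hy]
  | single g r =>
    obtain ⟨g, h⟩ := g
    simp [barD₂_single, Finsupp.mapDomain_single, Finsupp.mapDomain_add, sub_eq_add_neg,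
      ← Finsupp.single_neg]

/-- The effect of a homomorphism on `2`-cycles. -/
noncomputable def mapZ₂ (f : A →* B) (x : LinearMap.ker (barD₂ R A)) :
    LinearMap.ker (barD₂ R B) :=
  ⟨x.1.mapDomain (Prod.map f f), by
    rw [LinearMap.mem_ker, barD₂_mapDomain, LinearMap.mem_ker.1 x.2, Finsupp.mapDomain_zero]⟩

lemma trivHomologyMap_toH₂ (f : A →* B) (x : LinearMap.ker (barD₂ R A)) :
    trivHomologyMap R f 2 (toH₂ R x) = toH₂ R (mapZ₂ R f x) := by
  have h := H2π_comp_map (k := ULift.{u} R) (f := f) (φ := trivRepMap R f)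
  refine (LinearMap.congr_fun (congrArg ModuleCat.Hom.hom h) x).trans ?_
  refine congrArg (H2π (Rep.trivial (ULift.{u} R) B (ULift.{u} R))).hom (Subtype.ext ?_)
  refine (coe_mapCycles₂ _ _ _).trans ?_
  exact Finsupp.mapRange_id _

lemma trivHomologyMap_comp {C : Type u} [Group C] (f : A →* B) (g : B →* C) (i : ℕ)
    (x : trivHomology R A i) :
    trivHomologyMap R (g.comp f) i x = trivHomologyMap R g i (trivHomologyMap R f i x) := by
  have := groupHomology.map_comp f g (trivRepMap R f) (trivRepMap R g) i
  exact LinearMap.congr_fun (congrArg ModuleCat.Hom.hom this) x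

lemma trivHomologyMap_id (i : ℕ) (x : trivHomology R A i) :
    trivHomologyMap R (MonoidHom.id A) i x = x := by
  have := groupHomology.map_id (G := A) (A := Rep.trivial (ULift.{u} R) A (ULift.{u} R)) (n := i)
  exact LinearMap.congr_fun (congrArg ModuleCat.Hom.hom this) x

end BarChains

/-! ### `H_1` and homomorphisms to modules -/

section FirstHomology

variable (R : Type) [CommRing R] {A B : Type u} [Group A] [Group B]
  {M : Type u} [AddCommGroup M] [Module (ULift.{u} R) M]

/-- The coboundary of a function `β : A → M`, for the trivial action of `A` on `M`. -/
def coboundary (β : A → M) (x : A × A) : M := β x.2 - β (x.1 * x.2) + β x.1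

lemma linearCombination_barD₂ (β : A → M) (x : A × A →₀ ULift.{u} R) :
    Finsupp.linearCombination (ULift.{u} R) β (barD₂ R A x) =
      Finsupp.linearCombination (ULift.{u} R) (coboundary β) x := by
  induction x using Finsupp.induction_linear with
  | zero => simp
  | add x y hx hy => simp [hx, hy]
  | single g r =>
    obtain ⟨g, h⟩ := g
    simp [barD₂_single, coboundary, smul_add, smul_sub]

variable (A) in
/-- The universal homomorphism from `A` to a module, `A → H_1(A; R)`. -/
noncomputable def homToH₁ : A →* Multiplicative (trivHomology R A 1) :=
  MonoidHom.mk' (fun a => Multiplicative.ofAdd (toH₁ R (Finsupp.single a 1))) fun g h => by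
    rw [← ofAdd_add]
    refine congrArg Multiplicative.ofAdd ?_
    have := (toH₁_eq_zero_iff R _).2 ⟨Finsupp.single (g, h) 1, rfl⟩
    rw [barD₂_single, map_add, map_sub, sub_add_eq_add_sub, sub_eq_zero] at this
    rw [← this, add_comm]

lemma trivHomology_one_hom_ext {φ ψ : trivHomology R A 1 →ₗ[ULift.{u} R] M}
    (h : ∀ a, φ (homToH₁ R A a).toAdd = ψ (homToH₁ R A a).toAdd) : φ = ψ := by
  have : φ ∘ₗ toH₁ R = ψ ∘ₗ toH₁ R := Finsupp.lhom_ext' fun a => LinearMap.ext_ring (h a)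
  ext x
  obtain ⟨x, rfl⟩ := toH₁_surjective R x
  exact LinearMap.congr_fun this x

lemma exists_linearMap_H₁ (φ : A →* Multiplicative M) :
    ∃ l : trivHomology R A 1 →ₗ[ULift.{u} R] M, ∀ a, l (homToH₁ R A a).toAdd = (φ a).toAdd := by
  let β : A → M := fun a => (φ a).toAdd
  have hle : LinearMap.ker (toH₁ R (A := A)) ≤
      LinearMap.ker (Finsupp.linearCombination (ULift.{u} R) β) := by
    intro x hx
    obtain ⟨y, rfl⟩ := (toH₁_eq_zero_iff R x).1 hx
    have hβ : coboundary β = 0 := by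
      ext ⟨g, h⟩
      simp [coboundary, β]
    rw [LinearMap.mem_ker, linearCombination_barD₂, hβ]
    simp
  refine ⟨(LinearMap.ker (toH₁ R (A := A))).liftQ _ hle ∘ₗ
    ((toH₁ R (A := A)).quotKerEquivOfSurjective (toH₁_surjective R)).symm.toLinearMap, fun a => ?_⟩
  have : ((toH₁ R (A := A)).quotKerEquivOfSurjective (toH₁_surjective R)).symm
      (homToH₁ R A a).toAdd = Submodule.Quotient.mk (Finsupp.single a 1) := by
    rw [LinearEquiv.symm_apply_eq]
    rfl
  simp [this, β]

lemma trivHomologyMap_homToH₁ (f : A →* B) (a : A) :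
    trivHomologyMap R f 1 (homToH₁ R A a).toAdd = (homToH₁ R B (f a)).toAdd :=
  (trivHomologyMap_toH₁ R f _).trans (by rw [Finsupp.mapDomain_single]; rfl)

/-- Yoneda: `f` is an isomorphism on `H_1(-; R)` if and only if, for every `R`-module `M`, each
homomorphism `A → M` extends uniquely along `f`. -/
theorem bijective_trivHomologyMap_one_iff (f : A →* B) :
    Function.Bijective (trivHomologyMap R f 1) ↔
      ∀ (M : Type u) [AddCommGroup M] [Module (ULift.{u} R) M],
        Function.Bijective fun φ : B →* Multiplicative M => φ.comp f := by
  constructor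
  · intro hf M _ _
    constructor
    · intro φ ψ h
      obtain ⟨l, hl⟩ := exists_linearMap_H₁ R φ
      obtain ⟨m, hm⟩ := exists_linearMap_H₁ R ψ
      have hlm : l ∘ₗ trivHomologyMap R f 1 = m ∘ₗ trivHomologyMap R f 1 := by
        refine trivHomology_one_hom_ext R fun a => ?_
        rw [LinearMap.comp_apply, LinearMap.comp_apply, trivHomologyMap_homToH₁, hl, hm]
        exact congrArg Multiplicative.toAdd (DFunLike.congr_fun h a)
      have hlm' : l = m := by
        ext x
        obtain ⟨x, rfl⟩ := hf.2 x
        exact LinearMap.congr_fun hlm x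
      ext b
      exact Multiplicative.toAdd.injective (by rw [← hl, ← hm, hlm'])
    · intro φ
      obtain ⟨l, hl⟩ := exists_linearMap_H₁ R φ
      let e := LinearEquiv.ofBijective _ hf
      refine ⟨(AddMonoidHom.toMultiplicative
        (l ∘ₗ e.symm.toLinearMap).toAddMonoidHom).comp (homToH₁ R B), ?_⟩
      ext a
      refine Multiplicative.toAdd.injective ((?_ : l (e.symm _) = _).trans (hl a))
      congr 1
      rw [LinearEquiv.symm_apply_eq]
      exact (trivHomologyMap_homToH₁ R f a).symm
  · intro H
    constructor
    · obtain ⟨ψ, hψ⟩ := (H (trivHomology R A 1)).2 (homToH₁ R A)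
      obtain ⟨l, hl⟩ := exists_linearMap_H₁ R ψ
      have : l ∘ₗ trivHomologyMap R f 1 = LinearMap.id := by
        refine trivHomology_one_hom_ext R fun a => ?_
        rw [LinearMap.comp_apply, trivHomologyMap_homToH₁, hl, ← hψ]
        rfl
      exact Function.LeftInverse.injective fun x => LinearMap.congr_fun this x
    · let N := LinearMap.range (trivHomologyMap R f 1)
      have h1 := @(H (trivHomology R B 1 ⧸ N)).1
        ((AddMonoidHom.toMultiplicative N.mkQ.toAddMonoidHom).comp (homToH₁ R B)) 1 (by
          ext a
          refine Multiplicative.toAdd.injective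
            ((?_ : N.mkQ (homToH₁ R B (f a)).toAdd = 0))
          rw [← trivHomologyMap_homToH₁]
          exact (Submodule.Quotient.mk_eq_zero N).2 ⟨_, rfl⟩)
      have h2 : N.mkQ = 0 := trivHomology_one_hom_ext R fun b =>
        congrArg Multiplicative.toAdd (DFunLike.congr_fun h1 b)
      rw [← LinearMap.range_eq_top, ← Submodule.ker_mkQ (LinearMap.range _)]
      exact h2 ▸ LinearMap.ker_zero

end FirstHomology

/-! ### Cocycles that vanish on cycles -/

section Cocycles

variable (R : Type) [CommRing R] {A B : Type u} [Group A] [Group B]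
  {M : Type u} [AddCommGroup M] [Module (ULift.{u} R) M]

/-- A function on `A × A` whose linear extension kills the `2`-cycles becomes a coboundary in a
larger module. The larger module is `(C_1(A; R) ⊕ M) / {(∂x, -c(x))}`. -/
lemma exists_coboundary_of_vanishing (c : A × A → M)
    (hc : ∀ x ∈ LinearMap.ker (barD₂ R A), Finsupp.linearCombination (ULift.{u} R) c x = 0) :
    ∃ (W : Type u) (_ : AddCommGroup W) (_ : Module (ULift.{u} R) W)
      (ι : M →ₗ[ULift.{u} R] W) (w : A → W), Function.Injective ι ∧
        ∀ x, ι (c x) = coboundary w x := by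
  let L := LinearMap.range ((barD₂ R A).prod (-Finsupp.linearCombination (ULift.{u} R) c))
  refine ⟨((A →₀ ULift.{u} R) × M) ⧸ L, inferInstance, inferInstance,
    L.mkQ ∘ₗ LinearMap.inr _ _ _, fun a => L.mkQ (Finsupp.single a 1, 0), ?_, ?_⟩
  · rw [← LinearMap.ker_eq_bot, LinearMap.ker_eq_bot']
    intro m hm
    obtain ⟨x, hx⟩ := (Submodule.Quotient.mk_eq_zero L).1 hm
    obtain ⟨h1, h2⟩ := Prod.ext_iff.1 hx
    rw [← show _ = m from h2]
    simpa using hc x h1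
  · rintro ⟨g, h⟩
    rw [coboundary, ← map_sub, ← map_add]
    refine Eq.symm ((Submodule.Quotient.eq L).2 ⟨Finsupp.single (g, h) 1, ?_⟩)
    simp [barD₂_single]

/-- If `f` is an isomorphism on `H_1(-; R)`, then a function on `B × B` that is a coboundary in
some larger module, and whose restriction along `f` is a coboundary, is itself a coboundary. -/
lemma exists_coboundary_of_restriction {f : A →* B}
    (hf : Function.Bijective (trivHomologyMap R f 1)) {W : Type u} [AddCommGroup W]
    [Module (ULift.{u} R) W] {ι : M →ₗ[ULift.{u} R] W} (hι : Function.Injective ι)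
    {c : B × B → M} {w : B → W} (hw : ∀ x, ι (c x) = coboundary w x)
    {β : A → M} (hβ : ∀ x : A × A, c (f x.1, f x.2) = coboundary β x) :
    ∃ β' : B → M, ∀ x, c x = coboundary β' x := by
  have H := (bijective_trivHomologyMap_one_iff R f).1 hf
  -- The two trivialisations over `A` differ by a homomorphism, which extends to `B`.
  let δ : A →* Multiplicative W := MonoidHom.mk'
    (fun a => Multiplicative.ofAdd (w (f a) - ι (β a))) fun g h => by
      have h1 := hw (f g, f h)
      rw [hβ (g, h)] at h1
      simp only [coboundary, map_add, map_sub, ← map_mul] at h1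
      rw [← ofAdd_add]
      refine congrArg Multiplicative.ofAdd ?_
      rw [← sub_eq_zero] at h1 ⊢
      rw [← h1]
      abel
  obtain ⟨ψ, hψ⟩ := (H W).2 δ
  have hψ' : ∀ a, (ψ (f a)).toAdd = w (f a) - ι (β a) := fun a =>
    congrArg Multiplicative.toAdd (DFunLike.congr_fun hψ a)
  let N := LinearMap.range ι
  -- Modulo `M`, the difference `w - ψ` is a homomorphism that vanishes on `A`.
  let θ : B →* Multiplicative (W ⧸ N) := MonoidHom.mk'
    (fun b => Multiplicative.ofAdd (N.mkQ (w b - (ψ b).toAdd))) fun g h => by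
      rw [← ofAdd_add, ← map_add]
      refine congrArg Multiplicative.ofAdd ((Submodule.Quotient.eq N).2 ⟨-c (g, h), ?_⟩)
      rw [map_neg, hw (g, h), map_mul, toAdd_mul]
      simp only [coboundary]
      abel
  have hθ : θ = 1 := (H (W ⧸ N)).1 (by
    ext a
    refine congrArg Multiplicative.ofAdd ((Submodule.Quotient.mk_eq_zero N).2 ⟨β a, ?_⟩)
    rw [hψ' a, sub_sub_cancel])
  have hmem : ∀ b, ∃ m, ι m = w b - (ψ b).toAdd := fun b =>
    (Submodule.Quotient.mk_eq_zero N).1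
      (congrArg Multiplicative.toAdd (DFunLike.congr_fun hθ b))
  choose β' hβ' using hmem
  refine ⟨β', fun x => hι ?_⟩
  rw [hw, coboundary, coboundary, map_add, map_sub, hβ', hβ', hβ', map_mul, toAdd_mul]
  abel

end Cocycles

/-! ### The central extension of a cocycle -/

section CentralExtensions

variable {G M : Type u} [Group G] [AddCommGroup M]

/-- The `2`-cocycle identity for a function `c : G × G → M`, for the trivial action on `M`. -/
def IsTrivialCocycle (c : G × G → M) : Prop :=
  ∀ g h k, c (g, h) + c (g * h, k) = c (h, k) + c (g, h * k)

/-- The central extension of `G` by `M` determined by a `2`-cocycle, as a set `M × G`. -/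
@[ext] structure CocycleExtension {c : G × G → M} (hc : IsTrivialCocycle c) where
  /-- the component in the module -/
  fiber : M
  /-- the component in the group -/
  base : G

namespace CocycleExtension

variable {c : G × G → M} (hc : IsTrivialCocycle c)

instance : Mul (CocycleExtension hc) :=
  ⟨fun x y => ⟨x.fiber + y.fiber + c (x.base, y.base), x.base * y.base⟩⟩

instance : One (CocycleExtension hc) := ⟨⟨-c (1, 1), 1⟩⟩

instance : Inv (CocycleExtension hc) :=
  ⟨fun x => ⟨-x.fiber - c (x.base⁻¹, x.base) - c (1, 1), x.base⁻¹⟩⟩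

lemma mul_def (x y : CocycleExtension hc) :
    x * y = ⟨x.fiber + y.fiber + c (x.base, y.base), x.base * y.base⟩ := rfl

instance : Group (CocycleExtension hc) :=
  Group.ofLeftAxioms
    (fun x y z => by
      ext
      · change x.fiber + y.fiber + c (x.base, y.base) + z.fiber + c (x.base * y.base, z.base) =
          x.fiber + (y.fiber + z.fiber + c (y.base, z.base)) + c (x.base, y.base * z.base)
        have := hc x.base y.base z.base
        rw [← sub_eq_zero] at this ⊢
        rw [← this]
        abel
      · exact mul_assoc _ _ _)
    (fun x => by
      ext
      · change -c (1, 1) + x.fiber + c (1, x.base) = x.fiber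
        have := hc 1 1 x.base
        simp only [one_mul, add_left_inj] at this
        rw [this]
        abel
      · exact one_mul _)
    (fun x => by
      ext
      · change -x.fiber - c (x.base⁻¹, x.base) - c (1, 1) + x.fiber + c (x.base⁻¹, x.base) =
          -c (1, 1)
        abel
      · exact inv_mul_cancel _)

/-- The projection of the extension onto `G`. -/
def proj : CocycleExtension hc →* G where
  toFun := base
  map_one' := rfl
  map_mul' _ _ := rfl

/-- A trivialisation over `H` of the pulled back cocycle lifts `H → G` to the extension. -/
def lift {H : Type u} [Group H] (φ : H →* G) (β : H → M)
    (hβ : ∀ x : H × H, c (φ x.1, φ x.2) = coboundary β x) : H →* CocycleExtension hc :=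
  MonoidHom.mk' (fun h => ⟨-β h, φ h⟩) fun x y => by
    ext
    · change -β (x * y) = -β x + -β y + c (φ x, φ y)
      rw [hβ (x, y), coboundary]
      abel
    · exact map_mul φ x y

end CocycleExtension

end CentralExtensions

/-! ### Homology of pushouts of groups -/

section Pushout

variable (R : Type) [CommRing R] {A B B' C : Type u} [Group A] [Group B] [Group B'] [Group C]

/-- The universal property of a pushout square of groups. -/
structure IsGroupPushout (f : A →* B) (f' : A →* B') (g : B →* C) (g' : B' →* C) : Prop where
  comm : g.comp f = g'.comp f'
  exists_desc : ∀ {E : Type u} [Group E] (s : B →* E) (s' : B' →* E), s.comp f = s'.comp f' →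
    ∃ t : C →* E, t.comp g = s ∧ t.comp g' = s'
  hom_ext : ∀ {E : Type u} [Group E] {s t : C →* E}, s.comp g = t.comp g →
    s.comp g' = t.comp g' → s = t

lemma IsGroupPushout.symm {f : A →* B} {f' : A →* B'} {g : B →* C} {g' : B' →* C}
    (h : IsGroupPushout f f' g g') : IsGroupPushout f' f g' g where
  comm := h.comm.symm
  exists_desc s s' hs := (h.exists_desc s' s hs.symm).imp fun _ => And.symm
  hom_ext h1 h2 := h.hom_ext h2 h1

theorem exists_isGroupPushout (f : A →* B) (f' : A →* B') :
    ∃ (C : Type u) (_ : Group C) (g : B →* C) (g' : B' →* C), IsGroupPushout f f' g g' := by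
  let rel : Set (Monoid.Coprod B B') :=
    Set.range fun a => Monoid.Coprod.inl (f a) * (Monoid.Coprod.inr (f' a))⁻¹
  let N := Subgroup.normalClosure rel
  refine ⟨Monoid.Coprod B B' ⧸ N, inferInstance, (QuotientGroup.mk' N).comp Monoid.Coprod.inl,
    (QuotientGroup.mk' N).comp Monoid.Coprod.inr, ?_, ?_, ?_⟩
  · ext a
    refine (QuotientGroup.eq_iff_div_mem).2 ?_
    rw [div_eq_mul_inv]
    exact Subgroup.subset_normalClosure ⟨a, rfl⟩
  · intro E _ s s' h
    refine ⟨QuotientGroup.lift N (Monoid.Coprod.lift s s') ?_, ?_, ?_⟩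
    · refine Subgroup.normalClosure_le_normal ?_
      rintro _ ⟨a, rfl⟩
      have := DFunLike.congr_fun h a
      simp only [MonoidHom.comp_apply] at this
      simp [this]
    · ext b
      simp
    · ext b
      simp
  · intro E _ s t h h'
    refine QuotientGroup.monoidHom_ext _ (Monoid.Coprod.hom_ext ?_ ?_)
    · rw [MonoidHom.comp_assoc, h, MonoidHom.comp_assoc]
    · rw [MonoidHom.comp_assoc, h', MonoidHom.comp_assoc]

variable {f : A →* B} {f' : A →* B'} {g : B →* C} {g' : B' →* C}

/-- `H_1`-isomorphisms are stable under pushouts. -/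
theorem IsGroupPushout.bijective_H₁ (h : IsGroupPushout f f' g g')
    (hf' : Function.Bijective (trivHomologyMap R f' 1)) :
    Function.Bijective (trivHomologyMap R g 1) := by
  rw [bijective_trivHomologyMap_one_iff] at hf' ⊢
  intro M _ _
  constructor
  · intro s t hst
    refine h.hom_ext hst ((hf' M).1 ?_)
    change (s.comp g').comp f' = (t.comp g').comp f'
    rw [MonoidHom.comp_assoc, ← h.comm, ← MonoidHom.comp_assoc,
      show s.comp g = t.comp g from hst, MonoidHom.comp_assoc, h.comm, MonoidHom.comp_assoc]
  · intro φ
    obtain ⟨ψ, hψ⟩ := (hf' M).2 (φ.comp f)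
    obtain ⟨t, ht, -⟩ := h.exists_desc φ ψ hψ.symm
    exact ⟨t, ht⟩

/-- Part of the Mayer–Vietoris sequence of a pushout: if `A → B` is an isomorphism on `H_1`, then
`H_2(B) ⊕ H_2(B') → H_2(C)` is onto. On `C` the universal cocycle modulo the image becomes a
coboundary on `B` and on `B'` after enlarging the coefficients. The two resulting lifts to the
central extension of `C` can be made to agree on `A`, so they glue to a splitting. -/
theorem IsGroupPushout.exists_H₂_eq_add (h : IsGroupPushout f f' g g')
    (hf : Function.Bijective (trivHomologyMap R f 1)) (z : trivHomology R C 2) :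
    ∃ x y, z = trivHomologyMap R g 2 x + trivHomologyMap R g' 2 y := by
  let I := LinearMap.range (trivHomologyMap R g 2) ⊔ LinearMap.range (trivHomologyMap R g' 2)
  suffices hz : z ∈ I by
    obtain ⟨_, ⟨x, rfl⟩, _, ⟨y, rfl⟩, hxy⟩ := Submodule.mem_sup.1 hz
    exact ⟨x, y, hxy.symm⟩
  let Z := LinearMap.ker (barD₂ R C)
  let L : Submodule (ULift.{u} R) (C × C →₀ ULift.{u} R) :=
    (I.comap (toH₂ R)).map Z.subtype
  let c : C × C → (C × C →₀ ULift.{u} R) ⧸ L := fun x => L.mkQ (Finsupp.single x 1)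
  have hlin : Finsupp.linearCombination (ULift.{u} R) c = L.mkQ := by
    ext x
    simp [c]
  have hLZ : ∀ {x : Z}, L.mkQ x.1 = 0 → toH₂ R x ∈ I := by
    intro x hx
    obtain ⟨y, hy, hyx⟩ := (Submodule.Quotient.mk_eq_zero L).1 hx
    rwa [← Subtype.ext (a1 := y) hyx]
  have hZL : ∀ {x : Z}, toH₂ R x ∈ I → L.mkQ x.1 = 0 := fun {x} hx =>
    (Submodule.Quotient.mk_eq_zero L).2 ⟨x, hx, rfl⟩
  have hpull : ∀ {D : Type u} [Group D] (k : D →* C),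
      LinearMap.range (trivHomologyMap R k 2) ≤ I → ∀ x ∈ LinearMap.ker (barD₂ R D),
        Finsupp.linearCombination (ULift.{u} R) (fun y : D × D => c (k y.1, k y.2)) x = 0 := by
    intro D _ k hk x hx
    have : L.mkQ (mapZ₂ R k ⟨x, hx⟩).1 = 0 :=
      hZL (hk ⟨toH₂ R ⟨x, hx⟩, trivHomologyMap_toH₂ R k _⟩)
    rw [← hlin] at this
    exact (Finsupp.linearCombination_mapDomain (ULift.{u} R) (v' := c) (Prod.map k k) x).symm.trans
      this
  obtain ⟨W₁, _, _, ι₁, w₁, hι₁, hw₁⟩ := exists_coboundary_of_vanishing R _ (hpull g le_sup_left)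
  obtain ⟨W, _, _, ι₂, β', hι₂, hβ'⟩ := exists_coboundary_of_vanishing R
    (fun y : B' × B' => ι₁ (c (g' y.1, g' y.2))) (fun x hx => by
      have := Finsupp.apply_linearCombination (ULift.{u} R) ι₁
        (fun y : B' × B' => c (g' y.1, g' y.2)) x
      rw [hpull g' le_sup_right x hx, map_zero] at this
      exact this.symm)
  let ι := ι₂ ∘ₗ ι₁
  have hι : Function.Injective ι := hι₂.comp hι₁
  let β : B → W := fun b => ι₂ (w₁ b)
  have hβ : ∀ x : B × B, ι (c (g x.1, g x.2)) = coboundary β x := by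
    intro x
    simp only [ι, β, LinearMap.comp_apply, hw₁ x, coboundary, map_add, map_sub]
  have hcomm : ∀ a, g (f a) = g' (f' a) := DFunLike.congr_fun h.comm
  -- The difference of the two trivialisations over `A` extends to `B`.
  let δ : A →* Multiplicative W := MonoidHom.mk'
    (fun a => Multiplicative.ofAdd (β (f a) - β' (f' a))) fun x y => by
      have h1 := hβ (f x, f y)
      have h2 := hβ' (f' x, f' y)
      simp only [hcomm] at h1
      have h3 := h1.symm.trans h2
      rw [← ofAdd_add]
      refine congrArg Multiplicative.ofAdd ?_
      simp only [coboundary, ← map_mul] at h3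
      rw [← sub_eq_zero] at h3 ⊢
      rw [← neg_eq_zero, ← h3]
      abel
  obtain ⟨ψ, hψ⟩ := ((bijective_trivHomologyMap_one_iff R f).1 hf W).2 δ
  have hψ' : ∀ a, (ψ (f a)).toAdd = β (f a) - β' (f' a) := fun a =>
    congrArg Multiplicative.toAdd (DFunLike.congr_fun hψ a)
  have hc : IsTrivialCocycle fun x => ι (c x) := by
    intro x y k
    have h1 : L.mkQ (barD₃ R C (Finsupp.single (x, y, k) 1)) = 0 := by
      refine hZL (x := ⟨barD₃ R C (Finsupp.single (x, y, k) 1), ?_⟩) ?_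
      · rw [LinearMap.mem_ker]
        simp only [barD₃_single, barD₂_single, map_add, map_sub, mul_assoc]
        abel
      · rw [(toH₂_eq_zero_iff R _).2 ⟨_, rfl⟩]
        exact zero_mem _
    rw [barD₃_single, map_sub, map_add, map_sub] at h1
    change ι (c (x, y)) + ι (c (x * y, k)) = ι (c (y, k)) + ι (c (x, y * k))
    rw [← map_add ι, ← map_add ι]
    refine congrArg ι ?_
    rw [← sub_eq_zero] at h1 ⊢
    rw [← neg_eq_zero, ← h1]
    simp only [c]
    abel
  obtain ⟨t, ht, ht'⟩ := h.exists_desc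
    (CocycleExtension.lift hc g (fun b => β b - (ψ b).toAdd) (fun x => by
      rw [hβ]
      simp only [coboundary, map_mul, toAdd_mul]
      abel))
    (CocycleExtension.lift hc g' β' hβ') (by
      ext a
      · change -(β (f a) - (ψ (f a)).toAdd) = -β' (f' a)
        rw [hψ', sub_sub_cancel]
      · exact hcomm a)
  have hsec : (CocycleExtension.proj hc).comp t = MonoidHom.id C := by
    refine h.hom_ext ?_ ?_
    · rw [MonoidHom.comp_assoc, ht]
      rfl
    · rw [MonoidHom.comp_assoc, ht']
      rfl
  have hbase : ∀ x, (t x).base = x := DFunLike.congr_fun hsec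
  have hτ : (fun x => ι (c x)) = coboundary fun x => -(t x).fiber := by
    ext ⟨x, y⟩
    have := congrArg CocycleExtension.fiber (map_mul t x y)
    rw [CocycleExtension.mul_def] at this
    simp only [hbase] at this
    rw [coboundary, this]
    abel
  obtain ⟨z, rfl⟩ := toH₂_surjective R z
  refine hLZ (hι ?_)
  rw [← hlin, map_zero, Finsupp.apply_linearCombination]
  change Finsupp.linearCombination (ULift.{u} R) (fun x => ι (c x)) z.1 = 0
  rw [hτ, ← linearCombination_barD₂, LinearMap.mem_ker.1 z.2, map_zero]

end Pushout

/-! ### Dwyer classes are nested classes of maps -/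

section DwyerClass

variable (R : Type) [CommRing R] {A B C : Type u} [Group A] [Group B] [Group C]

/-- The terms of a normal series are preserved by all homomorphisms. -/
def NormalSeries.IsFunctorial (N : NormalSeries.{u}) : Prop :=
  ∀ (n : ℕ) {A B : Type u} [Group A] [Group B] (f : A →* B), N.term n A ≤ (N.term n B).comap f

variable {N : NormalSeries.{u}}

lemma dwyerPhi_le_comap (hN : N.IsFunctorial) (n : ℕ) (f : A →* B) :
    dwyerPhi R N n A ≤ (dwyerPhi R N n B).comap (trivHomologyMap R f 2) := by
  intro x hx
  have hcomm : (QuotientGroup.mk' (N.term (n - 1) B)).comp f =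
      (QuotientGroup.map _ _ f (hN (n - 1) f)).comp (QuotientGroup.mk' (N.term (n - 1) A)) := by
    ext a
    rfl
  change trivHomologyMap R _ 2 (trivHomologyMap R f 2 x) = 0
  rw [← trivHomologyMap_comp, hcomm, trivHomologyMap_comp, LinearMap.mem_ker.1 hx, map_zero]

lemma dwyerPhi_antitone (N : NormalSeries.{u}) (A : Type u) [Group A] (n : ℕ) :
    dwyerPhi R N (n + 1) A ≤ dwyerPhi R N n A := by
  have hle : N.term (n + 1 - 1) A ≤ N.term (n - 1) A := by
    cases n with
    | zero => exact le_rfl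
    | succ n => exact N.term_succ_le n A
  intro x hx
  have hcomm : QuotientGroup.mk' (N.term (n - 1) A) =
      (QuotientGroup.map _ _ (MonoidHom.id A) hle).comp
        (QuotientGroup.mk' (N.term (n + 1 - 1) A)) := by
    ext a
    rfl
  rw [dwyerPhi, LinearMap.mem_ker, hcomm, trivHomologyMap_comp, LinearMap.mem_ker.1 hx, map_zero]

/-- The epimorphism condition of the Dwyer class says that `H_2(B; R)` is spanned by the image of
`H_2(A; R)` together with `Φ_n(B)`. -/
lemma dwyerClass_iff (hN : N.IsFunctorial) (n : ℕ) (f : A →* B) :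
    dwyerClass R N n f ↔ Function.Bijective (trivHomologyMap R f 1) ∧
      ∀ y, ∃ x, y - trivHomologyMap R f 2 x ∈ dwyerPhi R N n B := by
  refine and_congr_right fun _ => ?_
  constructor
  · rintro ⟨h, hs⟩ y
    obtain ⟨x, hx⟩ := hs (Submodule.Quotient.mk y)
    obtain ⟨x, rfl⟩ := Submodule.Quotient.mk_surjective _ x
    exact ⟨x, (Submodule.Quotient.eq _).1 hx.symm⟩
  · intro h
    refine ⟨dwyerPhi_le_comap R hN n f, fun y => ?_⟩
    obtain ⟨y, rfl⟩ := Submodule.Quotient.mk_surjective _ y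
    obtain ⟨x, hx⟩ := h y
    exact ⟨Submodule.Quotient.mk x, ((Submodule.Quotient.eq _).2 hx).symm⟩

lemma dwyerClass_of_mulEquiv (hN : N.IsFunctorial) (n : ℕ) (e : A ≃* B) :
    dwyerClass R N n e.toMonoidHom := by
  have h1 : ∀ (i : ℕ) (y : trivHomology R B i),
      trivHomologyMap R e.toMonoidHom i (trivHomologyMap R e.symm.toMonoidHom i y) = y := by
    intro i y
    rw [← trivHomologyMap_comp, show e.toMonoidHom.comp e.symm.toMonoidHom = MonoidHom.id B by
      ext; simp, trivHomologyMap_id]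
  have h2 : ∀ (i : ℕ) (x : trivHomology R A i),
      trivHomologyMap R e.symm.toMonoidHom i (trivHomologyMap R e.toMonoidHom i x) = x := by
    intro i x
    rw [← trivHomologyMap_comp, show e.symm.toMonoidHom.comp e.toMonoidHom = MonoidHom.id A by
      ext; simp, trivHomologyMap_id]
  refine (dwyerClass_iff R hN n _).2 ⟨⟨Function.LeftInverse.injective (h2 1),
    Function.RightInverse.surjective (h1 1)⟩, fun y =>
    ⟨trivHomologyMap R e.symm.toMonoidHom 2 y, ?_⟩⟩
  rw [h1 2 y, sub_self]
  exact zero_mem _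

lemma dwyerClass_comp (hN : N.IsFunctorial) (n : ℕ) {f : A →* B} {g : B →* C}
    (hf : dwyerClass R N n f) (hg : dwyerClass R N n g) : dwyerClass R N n (g.comp f) := by
  rw [dwyerClass_iff R hN] at hf hg ⊢
  have hcomp : ∀ i x, trivHomologyMap R (g.comp f) i x =
      trivHomologyMap R g i (trivHomologyMap R f i x) := trivHomologyMap_comp R f g
  refine ⟨?_, fun z => ?_⟩
  · rw [show ⇑(trivHomologyMap R (g.comp f) 1) =
      trivHomologyMap R g 1 ∘ trivHomologyMap R f 1 from funext (hcomp 1)]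
    exact hg.1.comp hf.1
  · obtain ⟨y, hy⟩ := hg.2 z
    obtain ⟨x, hx⟩ := hf.2 y
    refine ⟨x, ?_⟩
    have := add_mem hy (dwyerPhi_le_comap R hN n g hx)
    rwa [map_sub, sub_add_sub_cancel, ← hcomp] at this

lemma dwyerClass_antitone (hN : N.IsFunctorial) (n : ℕ) {f : A →* B}
    (hf : dwyerClass R N (n + 1) f) : dwyerClass R N n f := by
  rw [dwyerClass_iff R hN] at hf ⊢
  exact ⟨hf.1, fun y => (hf.2 y).imp fun _ hx => dwyerPhi_antitone R N B n hx⟩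

/-- Dwyer classes are stable under pushouts along their own members. -/
lemma IsGroupPushout.dwyerClass (hN : N.IsFunctorial) (n : ℕ) {B' : Type u} [Group B'] {f : A →* B}
    {f' : A →* B'} {g : B →* C} {g' : B' →* C} (h : IsGroupPushout f f' g g')
    (hf : dwyerClass R N n f) (hf' : dwyerClass R N n f') : dwyerClass R N n g := by
  rw [dwyerClass_iff R hN] at hf hf' ⊢
  refine ⟨h.bijective_H₁ R hf'.1, fun z => ?_⟩
  obtain ⟨x, y, rfl⟩ := h.exists_H₂_eq_add R hf.1 z
  obtain ⟨w, hw⟩ := hf'.2 y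
  refine ⟨x + trivHomologyMap R f 2 w, ?_⟩
  have := dwyerPhi_le_comap R hN n g' hw
  rw [Submodule.mem_comap, map_sub, ← trivHomologyMap_comp, ← h.comm, trivHomologyMap_comp] at this
  rwa [map_add, add_sub_add_left_eq_sub]

theorem isNestedClassOfMaps_dwyerClass (hN : N.IsFunctorial) :
    IsNestedClassOfMaps (dwyerClass R N) where
  isClass n :=
    { of_mulEquiv := dwyerClass_of_mulEquiv R hN n
      comp := fun _ _ hf hg => dwyerClass_comp R hN n hf hg
      nudge_out := fun f f' hf hf' => by
        obtain ⟨C, _, g, g', h⟩ := exists_isGroupPushout f f'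
        exact ⟨C, _, g, g', h.dwyerClass R hN n hf hf', h.symm.dwyerClass R hN n hf' hf, h.comm⟩ }
  nested n _ _ _ _ _ hf := dwyerClass_antitone R hN n hf

end DwyerClass

/-! ### Extending homomorphisms to `R`-nilpotent groups -/

section Lifting

variable (R : Type) [CommRing R]

/-- A group is `R`-nilpotent of class at most `n` if it is obtained from the trivial group by `n`
successive central extensions whose kernels are (underlying groups of) `R`-modules. -/
def IsRNilpotent : ℕ → ∀ (K : Type u) [Group K], Prop
  | 0, K, _ => Subsingleton K
  | n + 1, K, _ => ∃ (M : Type u) (_ : AddCommGroup M) (_ : Module R M) (K' : Type u)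
      (_ : Group K') (i : Multiplicative M →* K) (π : K →* K'),
      Function.Injective i ∧ Function.Surjective π ∧ π.ker = i.range ∧
        (∀ m k, i m * k = k * i m) ∧ IsRNilpotent n K'

/-- Dwyer's theorem in terms of homomorphisms out of `A`: along a map `A → B` in the `n`-th Dwyer
class, every homomorphism to an `R`-nilpotent group of class at most `n` extends.
Inductively `A → K → K'` extends to `B → K'`, which factors through `B / N^{n-1}(B)`; the
obstruction to lifting `B → K'` to `K` comes from there and vanishes on `A`. By the `H_2` condition
it vanishes on all `2`-cycles of `B`, and by the `H_1` condition it vanishes altogether. -/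
theorem exists_extension_of_dwyerClass {N : NormalSeries.{u}} (hN : N.IsFunctorial)
    (hker : ∀ (n : ℕ) {B K : Type u} [Group B] [Group K] (φ : B →* K), IsRNilpotent R n K →
      N.term n B ≤ φ.ker)
    {A B : Type u} [Group A] [Group B] (f : A →* B) (n : ℕ) (hf : dwyerClass R N n f)
    {K : Type u} [Group K] (hK : IsRNilpotent R n K) (φ : A →* K) :
    ∃ ψ : B →* K, ψ.comp f = φ := by
  induction n generalizing K with
  | zero =>
    have : Subsingleton K := hK
    exact ⟨1, by ext; exact Subsingleton.elim _ _⟩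
  | succ n ih =>
    obtain ⟨M, _, _, K', _, i, π, hi, hπ, hex, hcen, hK'⟩ := hK
    obtain ⟨χ, hχ⟩ := ih (dwyerClass_antitone R hN n hf) hK' (π.comp φ)
    have hχ' : ∀ a, χ (f a) = π (φ a) := DFunLike.congr_fun hχ
    obtain ⟨hf₁, hf₂⟩ := (dwyerClass_iff R hN _ f).1 hf
    have hH := (bijective_trivHomologyMap_one_iff R f).1 hf₁ M
    -- two elements of `K` over the same element of `K'` differ by a unique element of `M`
    have hdiff : ∀ k l : K, π k = π l → ∃ m : M, k = i (Multiplicative.ofAdd m) * l := by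
      intro k l hkl
      have : k * l⁻¹ ∈ π.ker := by rw [MonoidHom.mem_ker, map_mul, map_inv, hkl, mul_inv_cancel]
      rw [hex] at this
      obtain ⟨m, hm⟩ := this
      exact ⟨m.toAdd, by rw [ofAdd_toAdd, hm, inv_mul_cancel_right]⟩
    have hcancel : ∀ {m m' : M} {k : K},
        i (Multiplicative.ofAdd m) * k = i (Multiplicative.ofAdd m') * k → m = m' := fun h =>
      Multiplicative.ofAdd.injective (hi (mul_right_cancel h))
    have hmul : ∀ (m m' : M) (k l : K), i (Multiplicative.ofAdd m) * k *
        (i (Multiplicative.ofAdd m') * l) = i (Multiplicative.ofAdd (m + m')) * (k * l) := by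
      intro m m' k l
      rw [ofAdd_add, map_mul, mul_assoc, ← mul_assoc k, ← hcen, mul_assoc, mul_assoc]
    have hact : ∀ (m m' : M) (k : K), i (Multiplicative.ofAdd m) *
        (i (Multiplicative.ofAdd m') * k) = i (Multiplicative.ofAdd (m + m')) * k := by
      intro m m' k
      rw [ofAdd_add, map_mul, mul_assoc]
    choose σ hσ using hπ
    have hσmul : ∀ x y, ∃ m : M, σ x * σ y = i (Multiplicative.ofAdd m) * σ (x * y) := by
      intro x y
      exact hdiff _ _ (by rw [map_mul, hσ, hσ, hσ])
    choose c' hc' using hσmul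
    let c : K' × K' → M := fun x => c' x.1 x.2
    have hc : ∀ x y, σ x * σ y = i (Multiplicative.ofAdd (c (x, y))) * σ (x * y) := hc'
    have hcocycle : IsTrivialCocycle c := by
      intro x y z
      refine hcancel (k := σ (x * y * z)) ?_
      rw [← hact, ← hc, ← mul_assoc, ← hc, mul_assoc, hc, ← mul_assoc, ← hcen, mul_assoc, hc, hact,
        mul_assoc x]
    have hcbd : ∀ x : K' × K' × K' →₀ ULift.{u} R,
        Finsupp.linearCombination (ULift.{u} R) c (barD₃ R K' x) = 0 := by
      intro x
      induction x using Finsupp.induction_linear with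
      | zero => simp
      | add x y hx hy => simp [hx, hy]
      | single g r =>
        obtain ⟨x, y, z⟩ := g
        have := congrArg (r • ·) (hcocycle x y z)
        simp only [smul_add] at this
        simp only [barD₃_single, map_sub, map_add, Finsupp.linearCombination_single]
        rw [← sub_eq_zero] at this
        rw [← neg_eq_zero, ← this]
        abel
    -- over `A` the cocycle is trivialised by `φ`
    have hβ : ∀ a, ∃ m : M, φ a = i (Multiplicative.ofAdd m) * σ (χ (f a)) := fun a =>
      hdiff _ _ (by rw [hσ, hχ'])
    choose β hβ using hβ
    have hcβ : ∀ x : A × A, c (χ (f x.1), χ (f x.2)) = coboundary (fun a => -β a) x := by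
      rintro ⟨x, y⟩
      have h1 := hβ (x * y)
      rw [map_mul, hβ x, hβ y, hmul, hc, hact, map_mul, map_mul] at h1
      have h2 := hcancel h1
      simp only [coboundary]
      rw [← h2]
      abel
    -- the cocycle on `B` vanishes on cycles
    have hvan : ∀ x ∈ LinearMap.ker (barD₂ R B),
        Finsupp.linearCombination (ULift.{u} R) (fun y : B × B => c (χ y.1, χ y.2)) x = 0 := by
      intro x hx
      obtain ⟨v, hv⟩ := hf₂ (toH₂ R ⟨x, hx⟩)
      obtain ⟨y, rfl⟩ := toH₂_surjective R v
      let χ' := QuotientGroup.lift (N.term n B) χ (hker n χ hK')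
      have h1 : trivHomologyMap R χ 2 (toH₂ R ⟨x, hx⟩ - trivHomologyMap R f 2 (toH₂ R y)) = 0 := by
        have : χ = χ'.comp (QuotientGroup.mk' (N.term n B)) := by
          ext b
          rfl
        rw [this, trivHomologyMap_comp]
        exact (congrArg _ hv).trans (map_zero _)
      rw [map_sub, trivHomologyMap_toH₂, trivHomologyMap_toH₂, trivHomologyMap_toH₂, ← map_sub,
        toH₂_eq_zero_iff] at h1
      obtain ⟨z, hz⟩ := h1
      have h2 := hcbd z
      rw [hz] at h2
      have h3 := (map_sub (Finsupp.linearCombination (ULift.{u} R) c) (mapZ₂ R χ ⟨x, hx⟩).1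
        (mapZ₂ R χ (mapZ₂ R f y)).1).symm.trans h2
      rw [sub_eq_zero] at h3
      simp only [mapZ₂, Finsupp.linearCombination_mapDomain] at h3
      refine h3.trans ?_
      rw [show (c ∘ Prod.map χ χ) ∘ Prod.map f f = coboundary fun a => -β a from funext hcβ,
        ← linearCombination_barD₂, LinearMap.mem_ker.1 y.2, map_zero]
    obtain ⟨W, _, _, ι, w, hι, hw⟩ := exists_coboundary_of_vanishing R _ hvan
    obtain ⟨γ, hγ⟩ := exists_coboundary_of_restriction R hf₁ hι hw hcβ
    -- a lift of `χ` to `K`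
    let χ₁ : B →* K := MonoidHom.mk' (fun b => i (Multiplicative.ofAdd (-γ b)) * σ (χ b))
      fun x y => by
        have := hγ (x, y)
        simp only at this
        rw [hmul, hc, hact, this, map_mul]
        congr 3
        simp only [coboundary]
        abel
    have hδ : ∀ a, ∃ m : M, φ a = i (Multiplicative.ofAdd m) * χ₁ (f a) := fun a =>
      ⟨β a + γ (f a), by simp [χ₁, hβ a]⟩
    choose δ hδ using hδ
    let δ' : A →* Multiplicative M := MonoidHom.mk' (fun a => Multiplicative.ofAdd (δ a))
      fun x y => by
        have := hδ (x * y)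
        rw [map_mul, hδ x, hδ y, hmul, map_mul, map_mul] at this
        rw [← ofAdd_add, hcancel this]
    obtain ⟨ε, hε⟩ := hH.2 δ'
    have hε' : ∀ a, ε (f a) = Multiplicative.ofAdd (δ a) := DFunLike.congr_fun hε
    refine ⟨MonoidHom.mk' (fun b => i (ε b) * χ₁ b) fun x y => ?_, ?_⟩
    · rw [map_mul, map_mul, map_mul, mul_assoc, ← mul_assoc (i (ε y)), hcen (ε y) (χ₁ x)]
      simp only [mul_assoc]
    · ext a
      exact (congrArg (fun m => i m * χ₁ (f a)) (hε' a)).trans (hδ a).symm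

end Lifting

/-! ### The stability criterion -/

section Stability

open scoped commutatorElement IsMulCommutative

variable {R : Type} [CommRing R]

/-- `N` vanishes on `R`-nilpotent groups: homomorphisms to an `R`-nilpotent group of class at most
`n` kill the `n`-th term of `N`. -/
def NormalSeries.VanishesOn (R : Type) [CommRing R] (N : NormalSeries.{u}) : Prop :=
  ∀ (n : ℕ) {B K : Type u} [Group B] [Group K] (φ : B →* K), IsRNilpotent R n K →
    N.term n B ≤ φ.ker

/-- A normal series `Γ` that vanishes on `R`-nilpotent groups and whose terms are detected by
homomorphisms to such groups is stable: a homomorphism `A → K` detecting `a` extends to `B`, so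
`f a` is detected as well. -/
theorem isStable_dwyerClass {Γ N : NormalSeries.{u}} (hΓ : Γ.IsFunctorial) (hN : N.IsFunctorial)
    (hΓR : Γ.VanishesOn R) (hNR : N.VanishesOn R)
    (hdetect : ∀ (n : ℕ) (A : Type u) [Group A], ∀ a ∉ Γ.term n A,
      ∃ (K : Type u) (_ : Group K) (φ : A →* K), IsRNilpotent R n K ∧ φ a ≠ 1) :
    Γ.IsStable (dwyerClass R N) where
  isNestedClass := isNestedClassOfMaps_dwyerClass R hN
  isInvariant n _ _ _ _ f _ := Subgroup.map_le_iff_le_comap.2 (hΓ n f)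
  stabilization_eq n A _ := by
    ext a
    constructor
    · rintro ⟨B, _, f, hf, ha⟩
      by_contra hna
      obtain ⟨K, _, φ, hK, hφ⟩ := hdetect n A a hna
      obtain ⟨ψ, rfl⟩ := exists_extension_of_dwyerClass R hN hNR f n hf hK φ
      exact hφ (hΓR n ψ hK ha)
    · exact fun ha => ⟨A, _, MonoidHom.id A, dwyerClass_of_mulEquiv R hN n (MulEquiv.refl A), ha⟩

lemma isMulCommutative_of_le_center {K : Type u} [Group K] {Z : Subgroup K}
    (hZ : Z ≤ Subgroup.center K) : IsMulCommutative Z :=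
  ⟨⟨fun a b => Subtype.ext (Subgroup.mem_center_iff.1 (hZ b.2) a)⟩⟩

lemma IsRNilpotent.of_surjective {K K' : Type u} [Group K] [Group K'] (π : K →* K')
    (hπ : Function.Surjective π) (hcen : π.ker ≤ Subgroup.center K) [IsMulCommutative π.ker]
    [Module R (Additive π.ker)] {n : ℕ} (h : IsRNilpotent R n K') : IsRNilpotent R (n + 1) K := by
  refine ⟨Additive π.ker, inferInstance, inferInstance, K', inferInstance,
    π.ker.subtype.comp (MulEquiv.multiplicativeAdditive π.ker).toMonoidHom, π,
    Subtype.val_injective, hπ, ?_, fun m k => (Subgroup.mem_center_iff.1 (hcen m.2) k).symm, h⟩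
  ext x
  exact ⟨fun hx => ⟨⟨x, hx⟩, rfl⟩, by rintro ⟨m, rfl⟩; exact m.2⟩

/-- The kernel of `A / Γ^{n+1}(A) → A / Γ^n(A)` is central if `[Γ^n(A), A] ⊆ Γ^{n+1}(A)`. -/
lemma ker_quotientMap_le_center {A : Type u} [Group A] {N P : Subgroup A} [N.Normal] [P.Normal]
    (hle : P ≤ N.comap (MonoidHom.id A)) (hcomm : ⁅N, (⊤ : Subgroup A)⁆ ≤ P) :
    (QuotientGroup.map P N (MonoidHom.id A) hle).ker ≤ Subgroup.center (A ⧸ P) := by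
  intro x hx
  induction x using QuotientGroup.induction_on with
  | H a =>
    have ha : a ∈ N := (QuotientGroup.eq_one_iff a).1 hx
    rw [Subgroup.mem_center_iff]
    intro y
    induction y using QuotientGroup.induction_on with
    | H b =>
      have : ⁅((a : A) : A ⧸ P), (b : A ⧸ P)⁆ = 1 :=
        (QuotientGroup.eq_one_iff ⁅a, b⁆).2
          (hcomm (Subgroup.commutator_mem_commutator ha (Subgroup.mem_top b)))
      exact (commutatorElement_eq_one_iff_mul_comm.1 this).symm

lemma quotientMap_surjective {A : Type u} [Group A] {N P : Subgroup A} [N.Normal] [P.Normal]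
    (hle : P ≤ N.comap (MonoidHom.id A)) :
    Function.Surjective (QuotientGroup.map P N (MonoidHom.id A) hle) :=
  QuotientGroup.map_surjective_of_surjective _ _ _
    (QuotientGroup.mk_surjective (s := N) : Function.Surjective (QuotientGroup.mk ∘ id)) hle

/-- The `n`-th term of a normal series is detected by the quotient by it, if that quotient is
`R`-nilpotent. -/
lemma exists_detecting_of_quotient {Γ : NormalSeries.{u}}
    (h : ∀ (n : ℕ) (A : Type u) [Group A], IsRNilpotent R n (A ⧸ Γ.term n A))
    (n : ℕ) (A : Type u) [Group A] (a : A) (ha : a ∉ Γ.term n A) :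
    ∃ (K : Type u) (_ : Group K) (φ : A →* K), IsRNilpotent R n K ∧ φ a ≠ 1 :=
  ⟨A ⧸ Γ.term n A, inferInstance, QuotientGroup.mk' _, h n A,
    fun h1 => ha ((QuotientGroup.eq_one_iff a).1 h1)⟩

lemma NormalSeries.subsingleton_quotient_zero (Γ : NormalSeries.{u}) (A : Type u) [Group A] :
    Subsingleton (A ⧸ Γ.term 0 A) := by
  rw [QuotientGroup.subsingleton_iff, Γ.term_zero]

end Stability

/-! ### The integral lower central series -/

section LowerCentral

open scoped IsMulCommutative

lemma lowerCentral_isFunctorial : lowerCentral.{u}.IsFunctorial := by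
  intro n A B _ _ f
  rw [← Subgroup.map_le_iff_le_comap]
  change ((⊤ : Subgroup A).lowerCentralSeries n).map f ≤ (⊤ : Subgroup B).lowerCentralSeries n
  rw [Subgroup.map_lowerCentralSeries]
  exact Subgroup.lowerCentralSeries_mono n le_top

/-- If `φ` maps `N` to the central subgroup `i(M)`, it kills `[N, B]`. -/
lemma commutator_le_ker {B K M : Type u} [Group B] [Group K] [Group M] {i : M →* K}
    {φ : B →* K} {N : Subgroup B} (hi : ∀ m k, i m * k = k * i m) (hN : ∀ x ∈ N, φ x ∈ i.range) :
    ⁅N, (⊤ : Subgroup B)⁆ ≤ φ.ker := by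
  rw [Subgroup.commutator_le]
  intro x hx y _
  obtain ⟨m, hm⟩ := hN x hx
  rw [MonoidHom.mem_ker, map_commutatorElement, commutatorElement_eq_one_iff_mul_comm, ← hm, hi]

lemma lowerCentral_vanishesOn (R : Type) [CommRing R] : lowerCentral.{u}.VanishesOn R := by
  intro n
  induction n with
  | zero =>
    intro B K _ _ φ hK x _
    have : Subsingleton K := hK
    exact Subsingleton.elim _ _
  | succ n ih =>
    rintro B K _ _ φ ⟨M, _, _, K', _, i, π, -, -, hex, hcen, hK'⟩
    exact commutator_le_ker hcen fun x hx => hex ▸ ih (π.comp φ) hK' hx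

lemma isRNilpotent_quotient_lowerCentral (n : ℕ) (A : Type u) [Group A] :
    IsRNilpotent ℤ n (A ⧸ lowerCentral.term n A) := by
  induction n with
  | zero => exact lowerCentral.subsingleton_quotient_zero A
  | succ n ih =>
    have hcen := ker_quotientMap_le_center (A := A) (lowerCentral.term_succ_le n A) le_rfl
    have := isMulCommutative_of_le_center hcen
    exact IsRNilpotent.of_surjective _ (quotientMap_surjective _) hcen ih

end LowerCentral

/-! ### The `ℤ/p`-lower central series -/

section ModP

open scoped IsMulCommutative

variable {p : ℕ}

lemma modPLowerCentral_isFunctorial : (modPLowerCentral.{u} p).IsFunctorial := by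
  intro n
  induction n with
  | zero => exact fun _ _ _ => trivial
  | succ n ih =>
    intro A B _ _ f
    refine sup_le ?_ ?_
    · rw [Subgroup.closure_le]
      rintro _ ⟨y, hy, rfl⟩
      refine Subgroup.mem_sup_left (Subgroup.subset_closure ⟨f y, ih f hy, (map_pow f y p).symm⟩)
    · refine Subgroup.commutator_le.2 fun x hx y _ => ?_
      rw [Subgroup.mem_comap, map_commutatorElement]
      exact Subgroup.mem_sup_right
        (Subgroup.commutator_mem_commutator (ih f hx) (Subgroup.mem_top _))

lemma modPLowerCentral_vanishesOn : (modPLowerCentral.{u} p).VanishesOn (ZMod p) := by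
  intro n
  induction n with
  | zero =>
    intro B K _ _ φ hK x _
    have : Subsingleton K := hK
    exact Subsingleton.elim _ _
  | succ n ih =>
    rintro B K _ _ φ ⟨M, _, _, K', _, i, π, -, -, hex, hcen, hK'⟩
    have hrange : ∀ x ∈ modPLCS B p n, φ x ∈ i.range := fun x hx => hex ▸ ih (π.comp φ) hK' hx
    refine sup_le ?_ (commutator_le_ker hcen hrange)
    rw [Subgroup.closure_le]
    rintro _ ⟨y, hy, rfl⟩
    obtain ⟨m, hm⟩ := hrange y hy
    have hp : m ^ p = 1 := Multiplicative.toAdd.injective (by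
      rw [toAdd_pow, toAdd_one, ← Nat.cast_smul_eq_nsmul (ZMod p), CharP.cast_eq_zero, zero_smul])
    change φ (y ^ p) = 1
    rw [map_pow, ← hm, ← map_pow, hp, map_one]

lemma isRNilpotent_quotient_modPLowerCentral (n : ℕ) (A : Type u) [Group A] :
    IsRNilpotent (ZMod p) n (A ⧸ (modPLowerCentral p).term n A) := by
  induction n with
  | zero => exact (modPLowerCentral p).subsingleton_quotient_zero A
  | succ n ih =>
    have := modPLCS_normal (A := A) p n
    have := modPLCS_normal (A := A) p (n + 1)
    have hcen := ker_quotientMap_le_center (A := A) ((modPLowerCentral p).term_succ_le n A)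
      le_sup_right
    have := isMulCommutative_of_le_center hcen
    let : Module (ZMod p) (Additive (QuotientGroup.map _ _ (MonoidHom.id A)
        ((modPLowerCentral p).term_succ_le n A)).ker) :=
      AddCommGroup.zmodModule (by
        rintro ⟨x, hx⟩
        refine Subtype.ext ?_
        induction x using QuotientGroup.induction_on with
        | H a =>
          have ha : a ∈ modPLCS A p n := (QuotientGroup.eq_one_iff a).1 hx
          exact (QuotientGroup.eq_one_iff (a ^ p)).2
            (Subgroup.mem_sup_left (Subgroup.subset_closure ⟨a, ha, rfl⟩)))
    exact IsRNilpotent.of_surjective _ (quotientMap_surjective _) hcen ih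

end ModP

/-! ### The rational lower central series -/

section Rational

lemma rationalLowerCentral_isFunctorial : rationalLowerCentral.{u}.IsFunctorial := by
  intro n
  induction n with
  | zero => exact fun _ _ _ => trivial
  | succ n ih =>
    intro A B _ _ f x hx
    obtain ⟨k, hk, hx⟩ := (mem_rationalLCS_succ n x).1 hx
    refine (mem_rationalLCS_succ n (f x)).2 ⟨k, hk, ?_⟩
    rw [← map_pow]
    have : ⁅(⊤ : Subgroup A), rationalLCS A n⁆ ≤ ⁅(⊤ : Subgroup B), rationalLCS B n⁆.comap f :=
      Subgroup.commutator_le.2 fun x _ y hy => by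
        rw [Subgroup.mem_comap, map_commutatorElement]
        exact Subgroup.commutator_mem_commutator (Subgroup.mem_top _) (ih f hy)
    exact this hx

lemma rationalLowerCentral_vanishesOn : rationalLowerCentral.{u}.VanishesOn ℚ := by
  intro n
  induction n with
  | zero =>
    intro B K _ _ φ hK x _
    have : Subsingleton K := hK
    exact Subsingleton.elim _ _
  | succ n ih =>
    rintro B K _ _ φ ⟨M, _, _, K', _, i, π, hi, -, hex, hcen, hK'⟩ x hx
    have hrange : ∀ x ∈ rationalLCS B n, φ x ∈ i.range := fun x hx => hex ▸ ih (π.comp φ) hK' hx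
    obtain ⟨m, hm⟩ := hrange x (rationalLCS_succ_le n hx)
    obtain ⟨k, hk, hxk⟩ := (mem_rationalLCS_succ n x).1 hx
    rw [Subgroup.commutator_comm] at hxk
    have h1 : φ (x ^ k) = 1 := commutator_le_ker hcen hrange hxk
    rw [map_pow, ← hm, ← map_pow, ← map_one i] at h1
    have h2 : k • m.toAdd = 0 := congrArg Multiplicative.toAdd (hi h1)
    rw [← Nat.cast_smul_eq_nsmul ℚ, smul_eq_zero, Nat.cast_eq_zero] at h2
    have h3 : m = 1 := Multiplicative.toAdd.injective (h2.resolve_left hk.ne')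
    rw [MonoidHom.mem_ker, ← hm, h3, map_one]

end Rational

/-! ### Nilpotent groups with unique roots -/

section UniquelyDivisible

/-- There is a `ℚ`-vector space structure on an abelian group on which all positive integers act
bijectively: `q • m` is the unique solution `y` of `q.den • y = q.num • m`. -/
theorem nonempty_module_rat {M : Type u} [AddCommGroup M]
    (h : ∀ k : ℕ, 0 < k → Function.Bijective fun x : M => k • x) : Nonempty (Module ℚ M) := by
  have hex : ∀ (q : ℚ) (m : M), ∃ y, q.den • y = q.num • m := fun q m => (h q.den q.pos).2 _
  choose act hact using hex
  have hcancel : ∀ {b : ℕ}, 0 < b → ∀ {x y : M}, (b : ℤ) • x = (b : ℤ) • y → x = y :=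
    fun hb x y hxy => (h _ hb).1 (by simpa using hxy)
  -- numerator and denominator may be replaced by any others
  have hfrac : ∀ (q : ℚ) (a : ℤ) (b : ℕ) (m : M), (a : ℚ) = q * b → (b : ℤ) • act q m = a • m := by
    intro q a b m hq
    refine hcancel q.pos ?_
    have h1 : (q.den : ℤ) • act q m = q.num • m := by simpa using hact q m
    have h2 : (b : ℤ) * q.num = q.den * a := by
      have : (q.den : ℚ) * q = q.num := Rat.den_mul_eq_num q
      have : (b : ℚ) * q.num = q.den * a := by rw [← this, hq]; ring
      exact_mod_cast this
    rw [smul_comm, h1, smul_smul, smul_smul, h2]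
  refine ⟨{ smul := act, one_smul := ?_, mul_smul := ?_, smul_zero := ?_, smul_add := ?_,
            add_smul := ?_, zero_smul := ?_ }⟩
  · intro p q m
    change act (p * q) m = act p (act q m)
    refine hcancel (Nat.mul_pos q.pos p.pos) ?_
    have hpq : ((q.num * p.num : ℤ) : ℚ) = p * q * (q.den * p.den : ℕ) := by
      push_cast
      rw [← Rat.den_mul_eq_num p, ← Rat.den_mul_eq_num q]
      ring
    have hp : (p.num : ℚ) = p * p.den := by rw [← Rat.den_mul_eq_num p, mul_comm]
    have hq : (q.num : ℚ) = q * q.den := by rw [← Rat.den_mul_eq_num q, mul_comm]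
    rw [hfrac _ _ _ _ hpq, Nat.cast_mul, mul_smul (q.den : ℤ), hfrac p _ _ _ hp, smul_comm,
      hfrac q _ _ _ hq, smul_smul, mul_comm p.num]
  · intro m
    change act 1 m = m
    simpa using hfrac 1 1 1 m (by simp)
  · intro q
    change act q 0 = 0
    refine hcancel q.pos ?_
    rw [hfrac q q.num q.den 0 (by rw [← Rat.den_mul_eq_num q, mul_comm]), smul_zero, smul_zero]
  · intro q x y
    change act q (x + y) = act q x + act q y
    have hq : (q.num : ℚ) = q * q.den := by rw [← Rat.den_mul_eq_num q, mul_comm]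
    refine hcancel q.pos ?_
    rw [smul_add, hfrac q _ _ _ hq, hfrac q _ _ _ hq, hfrac q _ _ _ hq, smul_add]
  · intro p q m
    change act (p + q) m = act p m + act q m
    have hp : ((p.num * q.den : ℤ) : ℚ) = p * (p.den * q.den : ℕ) := by
      push_cast
      rw [← Rat.den_mul_eq_num p]
      ring
    have hq : ((q.num * p.den : ℤ) : ℚ) = q * (p.den * q.den : ℕ) := by
      push_cast
      rw [← Rat.den_mul_eq_num q]
      ring
    refine hcancel (Nat.mul_pos p.pos q.pos) ?_
    rw [smul_add, hfrac p _ _ _ hp, hfrac q _ _ _ hq, ← add_smul]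
    refine hfrac _ _ _ _ ?_
    rw [Int.cast_add, hp, hq, add_mul]
  · intro m
    change act 0 m = 0
    simpa using hfrac 0 0 1 m (by simp)

open scoped IsMulCommutative in
/-- A nilpotent group with unique roots is `ℚ`-nilpotent, by induction along the upper central
series: unique roots are inherited by the centre and by the quotient by the centre. -/
theorem isRNilpotent_rat_of_bijective_pow (n : ℕ) (K : Type u) [Group K]
    (hK : (⊤ : Subgroup K).lowerCentralSeries n = ⊥)
    (h : ∀ k : ℕ, 0 < k → Function.Bijective fun x : K => x ^ k) : IsRNilpotent ℚ n K := by
  induction n generalizing K with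
  | zero => exact ⟨fun x y => (Subgroup.eq_bot_iff_forall ⊤).1 hK x trivial |>.trans
      ((Subgroup.eq_bot_iff_forall ⊤).1 hK y trivial).symm⟩
  | succ n ih =>
    -- roots of central elements are central
    have hroot : ∀ (k : ℕ), 0 < k → ∀ x : K, x ^ k ∈ Subgroup.center K →
        x ∈ Subgroup.center K := by
      intro k hk x hx
      rw [Subgroup.mem_center_iff] at hx ⊢
      intro g
      have : (g * x * g⁻¹) ^ k = x ^ k := by
        rw [conj_pow, hx g, mul_inv_cancel_right]
      exact mul_inv_eq_iff_eq_mul.1 ((h k hk).1 this)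
    have hker : (QuotientGroup.mk' (Subgroup.center K)).ker = Subgroup.center K :=
      QuotientGroup.ker_mk' _
    have := isMulCommutative_of_le_center hker.le
    obtain ⟨_⟩ : Nonempty (Module ℚ (Additive (QuotientGroup.mk' (Subgroup.center K)).ker)) := by
      refine nonempty_module_rat fun k hk => ⟨fun x y hxy => ?_, fun x => ?_⟩
      · exact Subtype.ext ((h k hk).1 (congrArg Subtype.val hxy))
      · obtain ⟨y, hy⟩ := (h k hk).2 x.toMul.1
        refine ⟨Additive.ofMul ⟨y, ?_⟩, Subtype.ext hy⟩
        rw [hker]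
        refine hroot k hk y ?_
        rw [show y ^ k = x.toMul.1 from hy]
        exact hker.le x.toMul.2
    refine IsRNilpotent.of_surjective _ (QuotientGroup.mk'_surjective (Subgroup.center K)) hker.le
      (ih _ ?_ fun k hk => ⟨fun x y hxy => ?_, fun x => ?_⟩)
    · have hle : (⊤ : Subgroup K).lowerCentralSeries n ≤ Subgroup.center K := by
        rw [Subgroup.lowerCentralSeries_succ, Subgroup.commutator_eq_bot_iff_le_centralizer,
          Subgroup.coe_top, Subgroup.centralizer_univ] at hK
        exact hK
      rw [← Subgroup.map_top_of_surjective _ (QuotientGroup.mk'_surjective (Subgroup.center K)),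
        ← Subgroup.map_lowerCentralSeries, Subgroup.map_eq_bot_iff, hker]
      exact hle
    · induction x using QuotientGroup.induction_on with
      | H x =>
        induction y using QuotientGroup.induction_on with
        | H y =>
          obtain ⟨w, hw⟩ := (h k hk).2 ((x ^ k)⁻¹ * y ^ k)
          have hmem : (x ^ k)⁻¹ * y ^ k ∈ Subgroup.center K := QuotientGroup.eq.1 hxy
          have hwc : w ∈ Subgroup.center K := hroot k hk w (by rwa [show w ^ k = _ from hw])
          have hpow : (x * w) ^ k = y ^ k := by
            have hcomm : Commute x w := Subgroup.mem_center_iff.1 hwc x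
            rw [hcomm.mul_pow, show w ^ k = _ from hw, mul_inv_cancel_left]
          refine QuotientGroup.eq.2 ?_
          rwa [← (h k hk).1 hpow, inv_mul_cancel_left]
    · induction x using QuotientGroup.induction_on with
      | H x =>
        obtain ⟨y, rfl⟩ := (h k hk).2 x
        exact ⟨y, rfl⟩

end UniquelyDivisible

/-! ### Quotients that are `p`-groups, and their reduced products -/

section PGroups

lemma normal_of_le_center {G : Type u} [Group G] {H : Subgroup G} (h : H ≤ Subgroup.center G) :
    H.Normal :=
  ⟨fun x hx g => by rwa [Subgroup.mem_center_iff.1 (h hx) g, mul_inv_cancel_right]⟩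

/-- A finitely generated nilpotent group with `p`-primary centre is a `p`-group: `[x, -]` takes
values in the centre if `x` is central modulo the centre, so it is killed on the finitely many
generators by some power of `p`. -/
lemma isPGroup_of_center {p : ℕ} (G : Type u) [Group G] [Group.IsNilpotent G] [Group.FG G]
    (h : ∀ w ∈ Subgroup.center G, ∃ k : ℕ, w ^ p ^ k = 1) : IsPGroup p G := by
  suffices H : Group.FG G → (∀ w ∈ Subgroup.center G, ∃ k : ℕ, w ^ p ^ k = 1) → IsPGroup p G from
    H inferInstance h
  clear h
  refine Group.nilpotent_center_quotient_ind
    (P := fun G _ _ => Group.FG G → (∀ w ∈ Subgroup.center G, ∃ k : ℕ, w ^ p ^ k = 1) →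
      IsPGroup p G) G ?_ ?_
  · intro G _ _ _ _ g
    exact ⟨0, Subsingleton.elim _ _⟩
  · intro G _ _ ih _ hcen g
    have hquot : IsPGroup p (G ⧸ Subgroup.center G) := by
      refine ih inferInstance fun w hw => ?_
      induction w using QuotientGroup.induction_on with
      | H x =>
        have hx : ∀ g : G, ∃ c ∈ Subgroup.center G, g * x = c * (x * g) := by
          intro g
          refine ⟨g * x * (x * g)⁻¹, ?_, by group⟩
          rw [← QuotientGroup.eq_one_iff, QuotientGroup.mk_mul, QuotientGroup.mk_inv,
            QuotientGroup.mk_mul, QuotientGroup.mk_mul, Subgroup.mem_center_iff.1 hw g,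
            mul_inv_cancel]
        have hk : ∀ g : G, ∃ k : ℕ, ∀ j, k ≤ j → g * x ^ p ^ j = x ^ p ^ j * g := by
          intro g
          obtain ⟨c, hc, hgx⟩ := hx g
          obtain ⟨k, hk⟩ := hcen c hc
          have hcc : ∀ y, y * c = c * y := Subgroup.mem_center_iff.1 hc
          have hpow : ∀ m : ℕ, g * x ^ m = c ^ m * (x ^ m * g) := by
            intro m
            have h1 : g * x * g⁻¹ = c * x := by rw [hgx]; group
            have h2 : (c * x) ^ m = c ^ m * x ^ m := Commute.mul_pow (hcc x).symm m
            rw [← h1, conj_pow] at h2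
            rw [← mul_assoc, ← h2]
            group
          refine ⟨k, fun j hj => ?_⟩
          obtain ⟨i, rfl⟩ := Nat.exists_eq_add_of_le hj
          rw [hpow, pow_add, pow_mul c, hk, one_pow, one_mul]
        choose k hk using hk
        obtain ⟨S, hS⟩ := (Group.fg_def.1 ‹Group.FG G›)
        refine ⟨S.sup k, ?_⟩
        rw [← QuotientGroup.mk_pow, QuotientGroup.eq_one_iff, Subgroup.mem_center_iff]
        have hle : Subgroup.closure (S : Set G) ≤
            Subgroup.centralizer {x ^ p ^ S.sup k} := by
          rw [Subgroup.closure_le]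
          intro g hg
          rw [SetLike.mem_coe, Subgroup.mem_centralizer_singleton_iff]
          exact hk g _ (Finset.le_sup hg)
        intro g
        have hg : g ∈ Subgroup.closure (S : Set G) := hS ▸ Subgroup.mem_top g
        exact Subgroup.mem_centralizer_singleton_iff.1 (hle hg)
    obtain ⟨k, hk⟩ := hquot (g : G ⧸ Subgroup.center G)
    rw [← QuotientGroup.mk_pow, QuotientGroup.eq_one_iff] at hk
    obtain ⟨j, hj⟩ := hcen _ hk
    exact ⟨k + j, by rw [pow_add, pow_mul, hj]⟩

/-- A central element of infinite order in a finitely generated nilpotent group survives in a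
quotient that is a `p`-group: divide by a normal subgroup that is maximal among those that contain
`z ^ p` but not `z`. Every nontrivial subgroup of the centre of the quotient contains the image
of `z`, so the centre is `p`-primary. -/
lemma exists_isPGroup_quotient {p : ℕ} (hp : p.Prime) (G : Type u) [Group G] [Group.IsNilpotent G]
    [Group.FG G] {z : G} (hz : z ∈ Subgroup.center G) (hord : ∀ k : ℕ, 0 < k → z ^ k ≠ 1) :
    ∃ (N : Subgroup G) (_ : N.Normal), z ∉ N ∧ IsPGroup p (G ⧸ N) := by
  have hzcomm : ∀ y, y * z = z * y := Subgroup.mem_center_iff.1 hz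
  have hstart : (Subgroup.zpowers (z ^ p)).Normal ∧ z ^ p ∈ Subgroup.zpowers (z ^ p) ∧
      z ∉ Subgroup.zpowers (z ^ p) := by
    refine ⟨normal_of_le_center ?_, Subgroup.mem_zpowers _, ?_⟩
    · rw [Subgroup.zpowers_le]
      exact pow_mem hz p
    · rintro ⟨j, hj⟩
      have h1 : z ^ (p * j - 1 : ℤ) = 1 := by
        rw [zpow_sub_one, zpow_mul, zpow_natCast]
        exact mul_inv_eq_one.2 hj
      have h2 : (p * j - 1 : ℤ) ≠ 0 := fun h => by
        have : (p : ℤ) ∣ 1 := ⟨j, by linarith⟩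
        exact hp.one_lt.ne' (by exact_mod_cast Int.eq_one_of_dvd_one (by positivity) this)
      exact hord _ (Int.natAbs_pos.2 h2) (pow_natAbs_eq_one.2 h1)
  obtain ⟨N, -, hmax⟩ := zorn_le_nonempty₀
    {N : Subgroup G | N.Normal ∧ z ^ p ∈ N ∧ z ∉ N} (by
      intro c hc hchain N hN
      have hdir := hchain.directedOn
      refine ⟨sSup c, ⟨⟨fun x hx g => ?_⟩, ?_, fun hzc => ?_⟩, fun _ => le_sSup⟩
      · obtain ⟨P, hP, hxP⟩ := (Subgroup.mem_sSup_of_directedOn ⟨N, hN⟩ hdir).1 hx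
        exact le_sSup hP ((hc hP).1.conj_mem x hxP g)
      · exact le_sSup hN (hc hN).2.1
      · obtain ⟨P, hP, hzP⟩ := (Subgroup.mem_sSup_of_directedOn ⟨N, hN⟩ hdir).1 hzc
        exact (hc hP).2.2 hzP) _ hstart
  obtain ⟨hN, hzpN, hzN⟩ := hmax.prop
  have hzp : ((z : G) : G ⧸ N) ^ p = 1 := (QuotientGroup.eq_one_iff (z ^ p)).2 hzpN
  have hz1 : ((z : G) : G ⧸ N) ≠ 1 := fun h => hzN ((QuotientGroup.eq_one_iff z).1 h)
  have hmono : ∀ T : Subgroup (G ⧸ N), T.Normal → (z : G ⧸ N) ∉ T → T = ⊥ := by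
    intro T hT hzT
    have hle : N ≤ T.comap (QuotientGroup.mk' N) := fun x hx => by
      rw [Subgroup.mem_comap, QuotientGroup.mk'_apply, (QuotientGroup.eq_one_iff x).2 hx]
      exact one_mem _
    have := hmax.le_of_ge ⟨hT.comap _, hle hzpN, hzT⟩ hle
    rw [eq_bot_iff]
    intro x hx
    induction x using QuotientGroup.induction_on with
    | H x => exact (QuotientGroup.eq_one_iff x).2 (this hx)
  refine ⟨N, hN, hzN, isPGroup_of_center _ fun w hw => ?_⟩
  have hw' : ∀ k : ℕ, w ^ k ≠ 1 → (z : G ⧸ N) ∈ Subgroup.zpowers (w ^ k) := by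
    intro k hk
    by_contra hzT
    have hnormal : (Subgroup.zpowers (w ^ k)).Normal := normal_of_le_center (by
      rw [Subgroup.zpowers_le]
      exact pow_mem hw k)
    exact hk (Subgroup.zpowers_eq_bot.1 (hmono _ hnormal hzT))
  by_cases hw1 : w = 1
  · exact ⟨0, by simp [hw1]⟩
  have hfin : 0 < orderOf w := by
    obtain ⟨j, hj⟩ := hw' 1 (by simpa using hw1)
    simp only [pow_one] at hj
    rw [orderOf_pos_iff, isOfFinOrder_iff_zpow_eq_one]
    refine ⟨j * p, mul_ne_zero ?_ (by exact_mod_cast hp.ne_zero), ?_⟩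
    · rintro rfl
      exact hz1 (by rw [← hj, zpow_zero])
    · rw [zpow_mul, hj, zpow_natCast, hzp]
  obtain ⟨s, t, ht, hst⟩ := Nat.exists_eq_pow_mul_and_not_dvd hfin.ne' p hp.ne_one
  refine ⟨s, ?_⟩
  by_contra hne
  obtain ⟨j, hj⟩ := hw' _ hne
  have hzt : (z : G ⧸ N) ^ t = 1 := by
    rw [← hj]
    change ((w ^ p ^ s) ^ j) ^ t = 1
    rw [← zpow_natCast, zpow_comm, zpow_natCast, ← pow_mul, ← hst, pow_orderOf_eq_one, one_zpow]
  have hcop : p.Coprime t := (Nat.Prime.coprime_iff_not_dvd hp).2 ht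
  have := pow_gcd_eq_one.2 ⟨hzp, hzt⟩
  rw [hcop.gcd_eq_one, pow_one] at this
  exact hz1 this

open Filter in
/-- A central element of infinite order in a nilpotent group is detected by a homomorphism to a
nilpotent group, of no larger class, in which all roots exist and are unique. The target is a
reduced product, along pairs of a finite subset and a bound tending to infinity, of `p`-group
quotients of the finitely generated subgroups, with `p` above the bound: the `k`-th power map of a
`p`-group is bijective when `p > k`. -/
theorem exists_uniquelyDivisible_detecting (A : Type u) [Group A] {m : ℕ}
    (hA : (⊤ : Subgroup A).lowerCentralSeries m = ⊥) {z : A} (hz : z ∈ Subgroup.center A)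
    (hord : ∀ k : ℕ, 0 < k → z ^ k ≠ 1) :
    ∃ (K : Type u) (_ : Group K) (φ : A →* K), (⊤ : Subgroup K).lowerCentralSeries m = ⊥ ∧
      (∀ k : ℕ, 0 < k → Function.Bijective fun x : K => x ^ k) ∧ φ z ≠ 1 := by
  classical
  have hnil : Group.IsNilpotent A := Subgroup.nilpotent_iff_lowerCentralSeries.2 ⟨m, hA⟩
  let H : Finset A × ℕ → Subgroup A := fun i => Subgroup.closure (insert z i.1 : Finset A)
  have hzH : ∀ i, z ∈ H i := fun i => Subgroup.subset_closure (by simp)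
  have hmemH : ∀ a, ∀ᶠ i in atTop, a ∈ H i := fun a =>
    (eventually_ge_atTop ({a}, 0)).mono fun i hi =>
      Subgroup.subset_closure (by simp [Finset.singleton_subset_iff.1 hi.1])
  choose p hp hpp using fun i : Finset A × ℕ => Nat.exists_infinite_primes (i.2 + 1)
  have hquot : ∀ i, ∃ (N : Subgroup (H i)) (_ : N.Normal), (⟨z, hzH i⟩ : H i) ∉ N ∧
      IsPGroup (p i) (H i ⧸ N) := by
    intro i
    have : Group.FG (H i) := Group.closure_finset_fg _
    refine exists_isPGroup_quotient (hpp i) (H i) ?_ ?_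
    · exact Subgroup.mem_center_iff.2 fun g => Subtype.ext (Subgroup.mem_center_iff.1 hz g)
    · exact fun k hk h => hord k hk (congrArg Subtype.val h)
  choose N hN hzN hpN using hquot
  let E : Subgroup (∀ i, H i ⧸ N i) :=
    { carrier := {x | ∀ᶠ i in atTop, x i = 1}
      one_mem' := Eventually.of_forall fun _ => rfl
      mul_mem' := fun hx hy => by
        filter_upwards [hx, hy] with i hxi hyi
        rw [Pi.mul_apply, hxi, hyi, one_mul]
      inv_mem' := fun hx => by
        filter_upwards [hx] with i hxi
        rw [Pi.inv_apply, hxi, inv_one] }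
  have hE : E.Normal := ⟨fun x hx g => by
    filter_upwards [show ∀ᶠ i in atTop, x i = 1 from hx] with i hxi
    rw [Pi.mul_apply, Pi.mul_apply, hxi, mul_one, Pi.inv_apply, mul_inv_cancel]⟩
  have hEeq : ∀ x y : ∀ i, H i ⧸ N i, (x : (∀ i, H i ⧸ N i) ⧸ E) = y ↔
      ∀ᶠ i in atTop, x i = y i := by
    intro x y
    rw [QuotientGroup.eq]
    refine eventually_congr (Eventually.of_forall fun i => ?_)
    rw [Pi.mul_apply, Pi.inv_apply, inv_mul_eq_one]
  have hbij : ∀ k, 0 < k → ∀ᶠ i in atTop, Function.Bijective fun x : H i ⧸ N i => x ^ k :=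
    fun k hk => (eventually_ge_atTop ((∅, k) : Finset A × ℕ)).mono fun i hi => by
      have hlt : k < p i := (Nat.lt_succ_of_le hi.2).trans_le (hp i)
      exact ((hpN i).powEquiv (Nat.coprime_of_lt_prime hk.ne' hlt (hpp i))).bijective
  let θ : A → ∀ i, H i ⧸ N i := fun a i => if h : a ∈ H i then ((⟨a, h⟩ : H i) : H i ⧸ N i) else 1
  refine ⟨(∀ i, H i ⧸ N i) ⧸ E, inferInstance,
    MonoidHom.mk' (fun a => (θ a : (∀ i, H i ⧸ N i) ⧸ E)) fun a b => ?_, ?_, fun k hk => ⟨?_, ?_⟩,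
    fun h => ?_⟩
  · rw [← QuotientGroup.mk_mul, hEeq]
    filter_upwards [hmemH a, hmemH b] with i ha hb
    simp only [θ, Pi.mul_apply, dif_pos ha, dif_pos hb, dif_pos (mul_mem ha hb)]
    rfl
  · have hi : ∀ i, (⊤ : Subgroup (H i ⧸ N i)).lowerCentralSeries m = ⊥ := by
      intro i
      have h1 : (⊤ : Subgroup (H i)).lowerCentralSeries m = ⊥ := by
        rw [← (Subgroup.map_injective (H i).subtype_injective).eq_iff, Subgroup.map_bot,
          Subgroup.top_subtype_lowerCentralSeries, eq_bot_iff, ← hA]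
        exact Subgroup.lowerCentralSeries_mono m le_top
      rw [← Subgroup.map_top_of_surjective _ (QuotientGroup.mk'_surjective (N i)),
        ← Subgroup.map_lowerCentralSeries, h1, Subgroup.map_bot]
    rw [← Subgroup.map_top_of_surjective _ (QuotientGroup.mk'_surjective E),
      ← Subgroup.map_lowerCentralSeries]
    have h2 : (⊤ : Subgroup (∀ i, H i ⧸ N i)).lowerCentralSeries m = ⊥ := by
      rw [eq_bot_iff]
      refine (Subgroup.top_lowerCentralSeries_pi_le m).trans ?_
      rw [le_bot_iff, Subgroup.pi_eq_bot_iff]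
      exact hi
    rw [h2, Subgroup.map_bot]
  · intro x y hxy
    induction x using QuotientGroup.induction_on with
    | H x =>
      induction y using QuotientGroup.induction_on with
      | H y =>
        rw [hEeq]
        filter_upwards [hbij k hk, (hEeq (x ^ k) (y ^ k)).1 hxy] with i hi hxyi
        exact hi.1 hxyi
  · intro x
    induction x using QuotientGroup.induction_on with
    | H x =>
      have hroot : ∀ i, ∃ y, (Function.Bijective fun x : H i ⧸ N i => x ^ k) → y ^ k = x i := by
        intro i
        by_cases hi : Function.Bijective fun x : H i ⧸ N i => x ^ k
        · exact (hi.2 (x i)).imp fun _ hy _ => hy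
        · exact ⟨1, fun h => absurd h hi⟩
      choose y hy using hroot
      refine ⟨(y : (∀ i, H i ⧸ N i) ⧸ E), (hEeq (y ^ k) x).2 ?_⟩
      filter_upwards [hbij k hk] with i hi
      exact hy i hi
  · have h1 : ∀ᶠ i in atTop, θ z i = 1 := (hEeq (θ z) 1).1 h
    obtain ⟨i, hi⟩ := h1.exists
    simp only [θ, dif_pos (hzH i)] at hi
    exact hzN i ((QuotientGroup.eq_one_iff _).1 hi)

end PGroups

/-! ### Detection of the rational lower central series -/

section RationalDetection

lemma commutator_rationalLCS_le {A : Type u} [Group A] (n : ℕ) :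
    ⁅rationalLCS A n, (⊤ : Subgroup A)⁆ ≤ rationalLCS A (n + 1) := fun x hx =>
  (mem_rationalLCS_succ n x).2 ⟨1, one_pos, by rwa [pow_one, Subgroup.commutator_comm]⟩

lemma lowerCentralSeries_le_rationalLCS {A : Type u} [Group A] (n : ℕ) :
    (⊤ : Subgroup A).lowerCentralSeries n ≤ rationalLCS A n := by
  induction n with
  | zero => exact le_top
  | succ n ih => exact (Subgroup.commutator_mono ih le_rfl).trans (commutator_rationalLCS_le n)

/-- If `a` lies in `A^r_{i+1}` but not in `A^r_{i+2}`, its image in `A / A^r_{i+2}` is central of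
infinite order. -/
theorem exists_detecting_rationalLowerCentral (n : ℕ) (A : Type u) [Group A] (a : A)
    (ha : a ∉ rationalLowerCentral.term n A) :
    ∃ (K : Type u) (_ : Group K) (φ : A →* K), IsRNilpotent ℚ n K ∧ φ a ≠ 1 := by
  classical
  have hex : ∃ j, a ∉ rationalLCS A j := ⟨n, ha⟩
  obtain ⟨i, hi⟩ : ∃ i, Nat.find hex = i + 1 := by
    refine Nat.exists_eq_succ_of_ne_zero fun h0 => Nat.find_spec hex ?_
    rw [h0]
    trivial
  have hai : a ∈ rationalLCS A i := by
    by_contra h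
    exact Nat.find_min hex (hi ▸ Nat.lt_succ_self i) h
  have hai' : a ∉ rationalLCS A (i + 1) := hi ▸ Nat.find_spec hex
  have hin : i + 1 ≤ n := hi ▸ Nat.find_min' hex ha
  have := rationalLCS_normal (A := A) i
  have := rationalLCS_normal (A := A) (i + 1)
  have hnil : (⊤ : Subgroup (A ⧸ rationalLCS A (i + 1))).lowerCentralSeries (i + 1) = ⊥ := by
    rw [← Subgroup.map_top_of_surjective _ (QuotientGroup.mk'_surjective (rationalLCS A (i + 1))),
      ← Subgroup.map_lowerCentralSeries, Subgroup.map_eq_bot_iff, QuotientGroup.ker_mk']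
    exact lowerCentralSeries_le_rationalLCS _
  have hcen := ker_quotientMap_le_center (A := A) (rationalLCS_succ_le i)
    (commutator_rationalLCS_le i)
  obtain ⟨K, _, φ, hK, hpow, hφ⟩ := exists_uniquelyDivisible_detecting _ hnil
    (z := (a : A ⧸ rationalLCS A (i + 1))) (hcen ((QuotientGroup.eq_one_iff a).2 hai)) (by
      intro k hk h
      obtain ⟨m, hm, h⟩ := (mem_rationalLCS_succ i _).1 ((QuotientGroup.eq_one_iff (a ^ k)).1 h)
      exact hai' ((mem_rationalLCS_succ i a).2 ⟨k * m, Nat.mul_pos hk hm, by rwa [pow_mul]⟩))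
  refine ⟨K, _, φ.comp (QuotientGroup.mk' _), isRNilpotent_rat_of_bijective_pow n K ?_ hpow, hφ⟩
  exact le_bot_iff.1 (hK ▸ Subgroup.lowerCentralSeries_antitone _ hin)

end RationalDetection

theorem theorem3p2 :
    -- `R = ℤ`
    lowerCentral.{u}.IsStable (dwyerClass ℤ lowerCentral) ∧
    -- `R = ℚ`; `Φ_n` formed with `A / A_n`, and with `A / A^r_n`
    (rationalLowerCentral.{u}.IsStable (dwyerClass ℚ lowerCentral) ∧
      rationalLowerCentral.{u}.IsStable (dwyerClass ℚ rationalLowerCentral)) ∧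
    -- `R = ℤ/p`; `Φ_n` formed with `A / A_n`, and with `A / A_{p,n}`
    (∀ p : ℕ, p.Prime →
      (modPLowerCentral.{u} p).IsStable (dwyerClass (ZMod p) lowerCentral) ∧
      (modPLowerCentral.{u} p).IsStable (dwyerClass (ZMod p) (modPLowerCentral p))) := by
  refine ⟨?_, ⟨?_, ?_⟩, fun p _ => ⟨?_, ?_⟩⟩
  · exact isStable_dwyerClass lowerCentral_isFunctorial lowerCentral_isFunctorial
      (lowerCentral_vanishesOn ℤ) (lowerCentral_vanishesOn ℤ)
      (exists_detecting_of_quotient isRNilpotent_quotient_lowerCentral)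
  · exact isStable_dwyerClass rationalLowerCentral_isFunctorial lowerCentral_isFunctorial
      rationalLowerCentral_vanishesOn (lowerCentral_vanishesOn ℚ)
      exists_detecting_rationalLowerCentral
  · exact isStable_dwyerClass rationalLowerCentral_isFunctorial rationalLowerCentral_isFunctorial
      rationalLowerCentral_vanishesOn rationalLowerCentral_vanishesOn
      exists_detecting_rationalLowerCentral
  · exact isStable_dwyerClass modPLowerCentral_isFunctorial lowerCentral_isFunctorial
      modPLowerCentral_vanishesOn (lowerCentral_vanishesOn (ZMod p))
      (exists_detecting_of_quotient isRNilpotent_quotient_modPLowerCentral)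
  · exact isStable_dwyerClass modPLowerCentral_isFunctorial modPLowerCentral_isFunctorial
      modPLowerCentral_vanishesOn modPLowerCentral_vanishesOn
      (exists_detecting_of_quotient isRNilpotent_quotient_modPLowerCentral)
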